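/- Let $\mathbb{O}$ be the octonions with basis $e_0=1,e_1,\dots,e_7$, where $e_i^2=-1$, $e_ie_j=-e_je_i$ for distinct $i,j\ge 1$, and $e_4=e_1e_2$, $e_5=e_1e_3$, $e_6=e_2e_3$, $e_7=(e_1e_2)e_3$. Identify $z=x_0+\sum_{i=1}^7 x_ie_i$ with a point of $\mathbb{R}^8$, and write $\Re(z)=x_0$, $\overline z=x_0-\sum_{i=1}^7x_ie_i$, $|z|$ for the Euclidean norm and $dV$ for Lebesgue measure. Let $\mathcal{D}=\frac{\partial}{\partial x_0}+\sum_{i=1}^7 e_i\frac{\partial}{\partial x_i}$, acting from the left. For $d>0$ let $\mathcal{S}=\{z\in\mathbb{O}\mid 0<\Re(z)<d\}$, and let $\mathcal{B}^2(\mathcal{S})=L^2(\mathcal{S})\cap\operatorname{Ker}\mathcal{D}$ be the set of square-integrable, real differentiable functions $f:\mathcal{S}\to\mathbb{O}$ with $\mathcal{D}f=0$ on $\mathcal{S}$, with the inner product $$(f,g)_{\mathcal{S}}=\frac{3}{\pi^4}\int_{\mathcal{S}}\overline{g(z)}\,f(z)\,dV(z).$$ Let $\cot(z)=\sum_{m\in\mathbb{Z}}\frac{\overline{z+\pi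 m}}{|z+\pi m|^8}$ be the singly periodic $\mathbb{O}$-regular cotangent. Theorem. For every $d>0$ there is exactly one function $B_{\mathcal{S}}:\mathcal{S}\times\mathcal{S}\to\mathbb{O}$ such that for every $w\in\mathcal{S}$ one has $B_{\mathcal{S}}(\cdot,w)\in\mathcal{B}^2(\mathcal{S})$ and $f(w)=(f,B_{\mathcal{S}}(\cdot,w))_{\mathcal{S}}$ for all $f\in\mathcal{B}^2(\mathcal{S})$. For all $z,w\in\mathcal{S}$ it is given by $$B_{\mathcal{S}}(z,w)=-2\frac{\partial}{\partial x_0}\Big\{\Big(\frac{\pi}{2d}\Big)^7\cot\Big(\frac{\pi}{2d}(z+\overline w)\Big)\Big\}=-2\frac{\partial}{\partial x_0}\sum_{n\in\mathbb{Z}}\frac{\overline z+w+2dn}{|\overline z+w+2dn|^8}=-2\sum_{n\in\mathbb{Z}}\frac{\partial}{\partial x_0}\frac{\overline z+w+2dn}{|\overline z+w+2dn|^8},$$ where $x_0=\Re(z)$; here all denominators are nonzero, the partial derivatives exist, both series converge absolutely, and $\big(\frac{\pi}{2d}\big)^7\cot\big(\frac{\pi}{2d}(z+\overline w)\big)=\sum_{n\in\mathbb{Z}}\frac{\overline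 z+w+2dn}{|\overline z+w+2dn|^8}$. -/

import Mathlib

/-- The octonions, with underlying Euclidean space `ℝ⁸`; the coordinates `z 0, …, z 7` are those
of `z = x₀ + x₁ e₁ + ⋯ + x₇ e₇`.  Norm, topology and Lebesgue measure are those of `ℝ⁸`. -/
abbrev Octonion : Type := EuclideanSpace ℝ (Fin 8)

namespace Octonion

noncomputable section

/-- The standard basis; `e 0` is the unit element `1` of the octonions, and a real number `t`
is identified with `t • e 0`. -/
def e (i : Fin 8) : Octonion := EuclideanSpace.single i 1

/-- The real part. -/
def re (z : Octonion) : ℝ := z 0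

/-- Octonionic multiplication, in coordinates: `e 0` is the unit, `eᵢ² = -1`, `eᵢ eⱼ = - eⱼ eᵢ` for
distinct `i, j ≥ 1`, with `e₄ = e₁ e₂`, `e₅ = e₁ e₃`, `e₆ = e₂ e₃`, `e₇ = (e₁ e₂) e₃`. -/
def mul (a b : Octonion) : Octonion :=
  !₂[
    a 0 * b 0 - a 1 * b 1 - a 2 * b 2 - a 3 * b 3 - a 4 * b 4 - a 5 * b 5 - a 6 * b 6 - a 7 * b 7,
    a 0 * b 1 + a 1 * b 0 + a 2 * b 4 + a 3 * b 5 - a 4 * b 2 - a 5 * b 3 - a 6 * b 7 + a 7 * b 6,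
    a 0 * b 2 - a 1 * b 4 + a 2 * b 0 + a 3 * b 6 + a 4 * b 1 + a 5 * b 7 - a 6 * b 3 - a 7 * b 5,
    a 0 * b 3 - a 1 * b 5 - a 2 * b 6 + a 3 * b 0 - a 4 * b 7 + a 5 * b 1 + a 6 * b 2 + a 7 * b 4,
    a 0 * b 4 + a 1 * b 2 - a 2 * b 1 + a 3 * b 7 + a 4 * b 0 - a 5 * b 6 + a 6 * b 5 - a 7 * b 3,
    a 0 * b 5 + a 1 * b 3 - a 2 * b 7 - a 3 * b 1 + a 4 * b 6 + a 5 * b 0 - a 6 * b 4 + a 7 * b 2,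
    a 0 * b 6 + a 1 * b 7 + a 2 * b 3 - a 3 * b 2 - a 4 * b 5 + a 5 * b 4 + a 6 * b 0 - a 7 * b 1,
    a 0 * b 7 - a 1 * b 6 + a 2 * b 5 - a 3 * b 4 + a 4 * b 3 - a 5 * b 2 + a 6 * b 1 + a 7 * b 0]

/-- Octonionic conjugation. -/
def conj (a : Octonion) : Octonion :=
  !₂[a 0, -a 1, -a 2, -a 3, -a 4, -a 5, -a 6, -a 7]

/-- The partial derivative `∂f/∂xᵢ`. -/
def partialDeriv (i : Fin 8) (f : Octonion → Octonion) (z : Octonion) : Octonion :=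
  lineDeriv ℝ f z (e i)

/-- The octonionic Cauchy-Riemann operator `𝒟 = ∂/∂x₀ + ∑_{i=1}^7 eᵢ ∂/∂xᵢ`, acting from the
left. -/
def cauchyRiemann (f : Octonion → Octonion) (z : Octonion) : Octonion :=
  partialDeriv 0 f z + ∑ i : Fin 7, mul (e i.succ) (partialDeriv i.succ f z)

/-- Left `𝕆`-regularity on an open set `U`: real differentiable with `𝒟 f = 0` on `U`. -/
def IsLeftRegularOn (f : Octonion → Octonion) (U : Set Octonion) : Prop :=
  DifferentiableOn ℝ f U ∧ ∀ z ∈ U, cauchyRiemann f z = 0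

/-- Membership in the Bergman space `L²(U) ∩ Ker 𝒟`. -/
def MemBergmanSpace (U : Set Octonion) (f : Octonion → Octonion) : Prop :=
  MeasureTheory.MemLp f 2 (MeasureTheory.volume.restrict U) ∧ IsLeftRegularOn f U

/-- The Bergman inner product `(f, g)_U = (3 / π⁴) ∫_U conj (g z) * f z dV(z)`. -/
def bergmanInner (U : Set Octonion) (f g : Octonion → Octonion) : Octonion :=
  (3 / Real.pi ^ 4 : ℝ) • ∫ z in U, mul (conj (g z)) (f z)

/-- `K` is a reproducing kernel of the Bergman space of `U`: for `w ∈ U`, the function `K(·, w)`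
belongs to the space and `f w = (f, K(·, w))_U` for all `f` in the space. -/
def IsBergmanKernel (U : Set Octonion) (K : Octonion → Octonion → Octonion) : Prop :=
  ∀ w ∈ U, MemBergmanSpace U (fun z => K z w) ∧
    ∀ f : Octonion → Octonion, MemBergmanSpace U f → f w = bergmanInner U f (fun z => K z w)

/-- The strip `{z | 0 < Re z < d}`. -/
def strip (d : ℝ) : Set Octonion := {z | 0 < re z ∧ re z < d}

/-- The Cauchy kernel `q₀(z) = conj z / |z|⁸`. -/
def cauchyKernel (z : Octonion) : Octonion := (‖z‖ ^ 8)⁻¹ • conj z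

/-- The singly periodic `𝕆`-regular cotangent `cot z = ∑_{m ∈ ℤ} q₀(z + π m)`. -/
def cot (z : Octonion) : Octonion := ∑' m : ℤ, cauchyKernel (z + (Real.pi * m) • e 0)

/-- The summand `(conj z + w + 2dn) / |conj z + w + 2dn|⁸`. -/
def stripTerm (d : ℝ) (w : Octonion) (n : ℤ) (z : Octonion) : Octonion :=
  (‖conj z + w + (2 * d * n) • e 0‖ ^ 8)⁻¹ • (conj z + w + (2 * d * n) • e 0)

end

end Octonion

open MeasureTheory Filter Topology

namespace Octonion

noncomputable section

/-! The proof is a method of images. Write q₀ for the Cauchy kernel and P(u) = ∑ₙ q₀(u + 2dn), an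
odd, 2d-periodic function with poles on 2dℤ. For w in the strip, P(conj z + w) and P(w - z) agree on
both boundary hyperplanes, because conj z = -z where Re z = 0 and conj z = 2d - z where Re z = d.
Only the second has a pole in the strip, at z = w. Their difference is `stripDiff`.

The Cauchy kernel is regular from the right in the form ∑ᵢ (∂ᵢq₀)(eᵢ x) = 0 for every x
(`sum_regKernelDeriv_mul` at s = 0), a bracketing that survives the lack of associativity. So when
P(w - z) is paired with a regular f in Stokes' formula, only the pole contributes, and
`cauchyPompeiu` gives (π⁴/3) f(w), with π⁴/3 the area of the unit sphere. In P(conj z + w)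
conjugation reverses the sign of seven of the eight terms, which leaves a bulk term 2(∂₀P)(conj z +
w) (`sum_regKernelDeriv_conj_mul`). Subtraction gives, for test functions φ whose gradient vanishes
near w, ∫ φ · 2(∂₀P)(conj z + w) f + ∫ `stripDiff` · (∇φ f) = -(π⁴/3) φ(w) f(w).

A square-integrable f need not have boundary values, so φ runs through cutoffs that exhaust the
strip. With x₀ = Re z, their gradients are bounded by a constant over x₀(d - x₀), while away from w
`stripDiff` is O(x₀(d - x₀)(1 + |z|)⁻⁵) by `norm_stripDiff_le`. Since (1 + |z|)⁻⁵ is square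
integrable on ℝ⁸, dominated convergence removes the second integral (`integral_stripIntegrand`). As
conj B(z, w) = -2(∂₀P)(conj z + w), what remains is the reproducing formula. The same decay, with
the left regularity of ∂₀q₀, puts B(·, w) into the Bergman space. Uniqueness follows from conj(g) g
= |g|². -/

/-! ### Octonion algebra -/

theorem norm_sq_eq (a : Octonion) : ‖a‖ ^ 2 = a 0 ^ 2 + a 1 ^ 2 + a 2 ^ 2 + a 3 ^ 2 + a 4 ^ 2 +
    a 5 ^ 2 + a 6 ^ 2 + a 7 ^ 2 := by
  simp [EuclideanSpace.norm_sq_eq, Fin.sum_univ_eight]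

/-- Degen's eight-square identity, checked as a polynomial identity in the coordinates. -/
protected theorem norm_mul (a b : Octonion) : ‖mul a b‖ = ‖a‖ * ‖b‖ := by
  have h : ‖mul a b‖ ^ 2 = (‖a‖ * ‖b‖) ^ 2 := by
    rw [mul_pow, norm_sq_eq, norm_sq_eq, norm_sq_eq]
    simp [mul]
    ring
  exact (pow_left_inj₀ (norm_nonneg _) (by positivity) two_ne_zero).1 h

/-- Octonionic multiplication as a continuous bilinear map. -/
def mulL : Octonion →L[ℝ] Octonion →L[ℝ] Octonion :=
  LinearMap.mkContinuous₂
    (LinearMap.mk₂ ℝ mul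
      (by intro a b c; ext i; fin_cases i <;> simp [mul] <;> ring)
      (by intro r a b; ext i; fin_cases i <;> simp [mul] <;> ring)
      (by intro a b c; ext i; fin_cases i <;> simp [mul] <;> ring)
      (by intro r a b; ext i; fin_cases i <;> simp [mul] <;> ring)) 1
    (by intro a b; simp [Octonion.norm_mul])

theorem mulL_apply (a b : Octonion) : mulL a b = mul a b := rfl

theorem norm_conj (a : Octonion) : ‖conj a‖ = ‖a‖ := by
  refine (pow_left_inj₀ (norm_nonneg _) (norm_nonneg _) two_ne_zero).1 ?_
  rw [norm_sq_eq, norm_sq_eq]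
  simp [conj]

/-- Octonionic conjugation as a continuous linear map. -/
def conjL : Octonion →L[ℝ] Octonion :=
  LinearMap.mkContinuous
    { toFun := conj
      map_add' := by intro a b; ext i; fin_cases i <;> simp [conj] <;> ring
      map_smul' := by intro r a; ext i; fin_cases i <;> simp [conj] } 1
    (by intro a; simp [norm_conj])

theorem conjL_apply (a : Octonion) : conjL a = conj a := rfl

/-- A consequence of left alternativity; it replaces associativity in the computations with the
Cauchy kernel. -/
theorem conj_mul_mul (a x : Octonion) : mul (conj a) (mul a x) = ‖a‖ ^ 2 • x := by
  rw [norm_sq_eq]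
  ext i; fin_cases i <;> simp [mul, conj] <;> ring

theorem mul_conj (a : Octonion) : mul a (conj a) = ‖a‖ ^ 2 • e 0 := by
  rw [norm_sq_eq]
  ext i; fin_cases i <;> simp [mul, conj, e] <;> ring

theorem conj_mul (a : Octonion) : mul (conj a) a = ‖a‖ ^ 2 • e 0 := by
  rw [norm_sq_eq]
  ext i; fin_cases i <;> simp [mul, conj, e] <;> ring

theorem conj_conj (a : Octonion) : conj (conj a) = a := by
  ext i; fin_cases i <;> simp [conj]

theorem e_zero_mul (a : Octonion) : mul (e 0) a = a := by
  ext i; fin_cases i <;> simp [mul, e]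

theorem mul_e_zero (a : Octonion) : mul a (e 0) = a := by
  ext i; fin_cases i <;> simp [mul, e]

theorem conj_e_zero : conj (e 0) = e 0 := by
  ext i; fin_cases i <;> simp [conj, e]

theorem conj_e_succ (i : Fin 7) : conj (e i.succ) = -e i.succ := by
  ext j; fin_cases i <;> fin_cases j <;> simp [conj, e]

theorem norm_e (i : Fin 8) : ‖e i‖ = 1 := by simp [e]

theorem sum_coord_smul_e (z : Octonion) : ∑ i, z i • e i = z := by
  ext j; fin_cases j <;> simp [e, Fin.sum_univ_eight]

theorem inner_e (z : Octonion) (i : Fin 8) : inner ℝ z (e i) = z i := by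
  simp [e, EuclideanSpace.inner_single_right]

/-- The operator `L ↦ ∑ᵢ eᵢ L(eᵢ)` through which `𝒟` acts on derivatives. -/
def leftSymbol (L : Octonion →L[ℝ] Octonion) : Octonion := ∑ i, mul (e i) (L (e i))

theorem cauchyRiemann_eq_leftSymbol {f : Octonion → Octonion} {z : Octonion}
    {L : Octonion →L[ℝ] Octonion} (h : HasFDerivAt f L z) :
    cauchyRiemann f z = leftSymbol L := by
  have h' (i : Fin 8) : partialDeriv i f z = L (e i) := (h.hasLineDerivAt (e i)).lineDeriv
  simp only [cauchyRiemann, leftSymbol, h', Fin.sum_univ_succ (n := 7), e_zero_mul]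

theorem mul_sum_right {ι : Type*} (s : Finset ι) (a : Octonion) (b : ι → Octonion) :
    mul a (∑ i ∈ s, b i) = ∑ i ∈ s, mul a (b i) := map_sum (mulL a) b s

theorem mul_sum_left {ι : Type*} (s : Finset ι) (a : ι → Octonion) (b : Octonion) :
    mul (∑ i ∈ s, a i) b = ∑ i ∈ s, mul (a i) b := map_sum (mulL.flip b) a s

protected theorem smul_mul (r : ℝ) (a b : Octonion) : mul (r • a) b = r • mul a b := by
  simp [← mulL_apply]

protected theorem mul_smul (r : ℝ) (a b : Octonion) : mul a (r • b) = r • mul a b := by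
  simp [← mulL_apply]

protected theorem mul_add (a b c : Octonion) : mul a (b + c) = mul a b + mul a c := by
  simp [← mulL_apply]

protected theorem sub_mul (a b c : Octonion) : mul (a - b) c = mul a c - mul b c := by
  simp [← mulL_apply]

protected theorem mul_sub (a b c : Octonion) : mul a (b - c) = mul a b - mul a c := by
  simp [← mulL_apply]

protected theorem neg_mul (a b : Octonion) : mul (-a) b = -mul a b := by
  simp [← mulL_apply]

theorem conj_add (a b : Octonion) : conj (a + b) = conj a + conj b := map_add conjL a b

theorem conj_sub (a b : Octonion) : conj (a - b) = conj a - conj b := map_sub conjL a b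

theorem conj_neg (a : Octonion) : conj (-a) = -conj a := map_neg conjL a

theorem conj_smul (r : ℝ) (a : Octonion) : conj (r • a) = r • conj a := map_smul conjL r a

theorem re_add (a b : Octonion) : re (a + b) = re a + re b := rfl

theorem abs_re_le_norm (a : Octonion) : |re a| ≤ ‖a‖ := by
  simpa [re] using PiLp.norm_apply_le a 0

theorem sum_conj_e_mul_e_mul (x : Octonion) :
    ∑ i, mul (conj (e i)) (mul (e i) x) = (8 : ℝ) • x := by
  simp [conj_mul_mul, norm_e, ← Nat.cast_smul_eq_nsmul ℝ]

theorem sum_coord_e_mul (z x : Octonion) : ∑ i, z i • mul (e i) x = mul z x := by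
  conv_rhs => rw [← sum_coord_smul_e z, mul_sum_left]
  simp [Octonion.smul_mul]

/-! ### The Cauchy kernel, its regularization and its derivatives -/

/-- The regularized Cauchy kernel `conj z / (|z|² + s)⁴`. -/
def regKernel (s : ℝ) (z : Octonion) : Octonion := ((‖z‖ ^ 2 + s) ^ 4)⁻¹ • conj z

/-- The derivative of `regKernel s`. -/
def regKernelDeriv (s : ℝ) (z : Octonion) : Octonion →L[ℝ] Octonion :=
  ((‖z‖ ^ 2 + s) ^ 4)⁻¹ • conjL -
    (8 * ((‖z‖ ^ 2 + s) ^ 5)⁻¹) • (innerSL ℝ z).smulRight (conj z)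

theorem regKernelDeriv_apply (s : ℝ) (z h : Octonion) :
    regKernelDeriv s z h = ((‖z‖ ^ 2 + s) ^ 4)⁻¹ • conj h -
      (8 * ((‖z‖ ^ 2 + s) ^ 5)⁻¹) • inner ℝ z h • conj z := by
  simp [regKernelDeriv, conjL_apply]

theorem regKernel_zero : regKernel 0 = cauchyKernel := by
  ext z : 1
  simp [regKernel, cauchyKernel, ← pow_mul]

theorem hasFDerivAt_inv_norm_sq_add_pow (s : ℝ) (k : ℕ) (z : Octonion) (hz : ‖z‖ ^ 2 + s ≠ 0) :
    HasFDerivAt (fun y : Octonion => ((‖y‖ ^ 2 + s) ^ k)⁻¹)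
      ((-(2 * k * ((‖z‖ ^ 2 + s) ^ (k + 1))⁻¹)) • innerSL ℝ z) z := by
  have h1 : HasFDerivAt (fun y : Octonion => ‖y‖ ^ 2 + s) (2 • innerSL ℝ z) z :=
    (hasStrictFDerivAt_norm_sq z).hasFDerivAt.add_const s
  have h2 : HasDerivAt (fun t : ℝ => (t ^ k)⁻¹) (-(k * ((‖z‖ ^ 2 + s) ^ (k + 1))⁻¹))
      (‖z‖ ^ 2 + s) := by
    generalize ‖z‖ ^ 2 + s = M at hz
    convert! ((hasDerivAt_pow k M).inv (pow_ne_zero k hz)) using 1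
    rcases k with _ | k
    · simp
    · simp only [Nat.add_sub_cancel]
      field_simp
      ring
  have h3 := h2.comp_hasFDerivAt z h1
  convert! h3 using 1
  ext h
  simp
  ring

theorem hasFDerivAt_regKernel (s : ℝ) (z : Octonion) (hz : ‖z‖ ^ 2 + s ≠ 0) :
    HasFDerivAt (regKernel s) (regKernelDeriv s z) z := by
  have h := (hasFDerivAt_inv_norm_sq_add_pow s 4 z hz).smul conjL.hasFDerivAt
  convert! h using 1
  ext1 h
  simp [regKernelDeriv_apply, conjL_apply, smul_smul]
  module

/-- With M = |z|² + s, the two terms of the derivative give 8M⁻⁴ and -8|z|²M⁻⁵, whose sum is 8sM⁻⁵.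
At s = 0 this is right regularity of the Cauchy kernel; as s decreases to 0 the right-hand side
concentrates at the origin. -/
theorem sum_regKernelDeriv_mul (s : ℝ) (z x : Octonion) (hz : ‖z‖ ^ 2 + s ≠ 0) :
    ∑ i, mul (regKernelDeriv s z (e i)) (mul (e i) x) =
      (8 * s * ((‖z‖ ^ 2 + s) ^ 5)⁻¹) • x := by
  have h1 : ∑ i, z i • mul (conj z) (mul (e i) x) = ‖z‖ ^ 2 • x := by
    rw [← conj_mul_mul, ← sum_coord_e_mul z x, mul_sum_right]
    simp [Octonion.mul_smul]
  simp only [regKernelDeriv_apply, Octonion.sub_mul, Octonion.smul_mul, inner_e,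
    Finset.sum_sub_distrib, ← Finset.smul_sum, sum_conj_e_mul_e_mul, h1]
  rw [smul_smul, smul_smul, ← sub_smul]
  congr 1
  field_simp
  ring

/-- The derivative `∂q₀/∂x₀` of the Cauchy kernel. -/
def cauchyKernelDeriv (z : Octonion) : Octonion :=
  ((‖z‖ ^ 2) ^ 4)⁻¹ • e 0 - (8 * re z * ((‖z‖ ^ 2) ^ 5)⁻¹) • conj z

theorem regKernelDeriv_zero_e_zero (z : Octonion) :
    regKernelDeriv 0 z (e 0) = cauchyKernelDeriv z := by
  simp only [regKernelDeriv_apply, add_zero, conj_e_zero, inner_e, smul_smul, cauchyKernelDeriv, re]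
  congr 2
  ring

/-- The derivative of `cauchyKernelDeriv`. -/
def cauchyKernelDeriv₂ (z : Octonion) : Octonion →L[ℝ] Octonion :=
  (-(8 * ((‖z‖ ^ 2) ^ 5)⁻¹)) • (innerSL ℝ z).smulRight (e 0)
  - (8 * ((‖z‖ ^ 2) ^ 5)⁻¹) • (innerSL ℝ (e 0)).smulRight (conj z)
  - (8 * re z * ((‖z‖ ^ 2) ^ 5)⁻¹) • conjL
  + (80 * re z * ((‖z‖ ^ 2) ^ 6)⁻¹) • (innerSL ℝ z).smulRight (conj z)

theorem inner_e_zero_left (h : Octonion) : inner ℝ (e 0) h = re h := by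
  rw [real_inner_comm, inner_e, re]

theorem cauchyKernelDeriv₂_apply (z h : Octonion) :
    cauchyKernelDeriv₂ z h = (-(8 * ((‖z‖ ^ 2) ^ 5)⁻¹)) • inner ℝ z h • e 0
      - (8 * ((‖z‖ ^ 2) ^ 5)⁻¹) • re h • conj z
      - (8 * re z * ((‖z‖ ^ 2) ^ 5)⁻¹) • conj h
      + (80 * re z * ((‖z‖ ^ 2) ^ 6)⁻¹) • inner ℝ z h • conj z := by
  simp [cauchyKernelDeriv₂, conjL_apply, inner_e_zero_left]

theorem hasFDerivAt_cauchyKernelDeriv (z : Octonion) (hz : z ≠ 0) :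
    HasFDerivAt cauchyKernelDeriv (cauchyKernelDeriv₂ z) z := by
  have hz' : ‖z‖ ^ 2 + 0 ≠ 0 := by simpa using hz
  have hre : HasFDerivAt re (innerSL ℝ (e 0)) z := by
    convert! (innerSL ℝ (e 0)).hasFDerivAt using 1
    ext h
    simp [inner_e_zero_left]
  have h4 := (hasFDerivAt_inv_norm_sq_add_pow 0 4 z hz').smul_const (e 0)
  have h5 := ((hre.const_mul 8).mul (hasFDerivAt_inv_norm_sq_add_pow 0 5 z hz')).smul
    conjL.hasFDerivAt
  have h := h4.sub h5
  simp only [add_zero] at h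
  convert! h using 1
  ext1 h
  simp [cauchyKernelDeriv₂_apply, conjL_apply, smul_smul, inner_e_zero_left]
  module

/-- Since z + conj z = 2 Re z, the four terms are the multiples -16 (the first two together), -64
and +80 of Re z · |z|⁻¹⁰, and they cancel. -/
theorem leftSymbol_cauchyKernelDeriv₂ (z : Octonion) (hz : z ≠ 0) :
    leftSymbol (cauchyKernelDeriv₂ z) = 0 := by
  have hz' : ‖z‖ ≠ 0 := by simpa using hz
  have h1 : ∑ i, z i • mul (e i) (conj z) = ‖z‖ ^ 2 • e 0 := by
    rw [sum_coord_e_mul, mul_conj]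
  have h2 : ∑ i, re (e i) • mul (e i) (conj z) = conj z := by
    have h0 : re (e 0) = 1 := by simp [re, e]
    have h' (i : Fin 7) : re (e i.succ) = 0 := by simp [re, e]
    rw [Fin.sum_univ_succ]
    simp [h0, h', e_zero_mul]
  have h3 : ∑ i, z i • mul (e i) (e 0) = z := by
    simp only [mul_e_zero, sum_coord_smul_e]
  have h4 : conj z = (2 * re z) • e 0 - z := by
    ext i; fin_cases i <;> simp [conj, re, e]; ring
  simp only [leftSymbol, cauchyKernelDeriv₂_apply, Octonion.mul_sub, Octonion.mul_smul, inner_e,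
    Octonion.mul_add, Finset.sum_sub_distrib, Finset.sum_add_distrib, ← Finset.smul_sum, mul_conj,
    norm_e, one_pow, one_smul, h1, h2, h3, Finset.sum_const, Finset.card_univ, Fintype.card_fin,
    ← Nat.cast_smul_eq_nsmul ℝ]
  have h5 : ((‖z‖ ^ 2) ^ 5)⁻¹ = ((‖z‖ ^ 2) ^ 6)⁻¹ * ‖z‖ ^ 2 := by field_simp
  rw [h4, h5]
  push_cast
  match_scalars <;> ring

theorem conj_cauchyKernelDeriv (z : Octonion) :
    conj (cauchyKernelDeriv z) = cauchyKernelDeriv (conj z) := by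
  have : re (conj z) = re z := by simp [re, conj]
  simp only [cauchyKernelDeriv, conj_sub, conj_smul, conj_e_zero, norm_conj, this]

theorem conj_cauchyKernel (z : Octonion) : conj (cauchyKernel z) = cauchyKernel (conj z) := by
  simp only [cauchyKernel, conj_smul, norm_conj]

theorem norm_cauchyKernel (z : Octonion) : ‖cauchyKernel z‖ = (‖z‖ ^ 7)⁻¹ := by
  rw [cauchyKernel, norm_smul, norm_conj, norm_inv, norm_pow, norm_norm]
  rcases eq_or_ne ‖z‖ 0 with h | h
  · simp [h]
  · field_simp

theorem norm_cauchyKernelDeriv_le (z : Octonion) : ‖cauchyKernelDeriv z‖ ≤ 9 * (‖z‖ ^ 8)⁻¹ := by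
  rcases eq_or_ne ‖z‖ 0 with h | h
  · simp [cauchyKernelDeriv, h]
  calc ‖cauchyKernelDeriv z‖ ≤ ‖((‖z‖ ^ 2) ^ 4)⁻¹ • e 0‖ +
        ‖(8 * re z * ((‖z‖ ^ 2) ^ 5)⁻¹) • conj z‖ := norm_sub_le _ _
    _ = ((‖z‖ ^ 2) ^ 4)⁻¹ + 8 * |re z| * ((‖z‖ ^ 2) ^ 5)⁻¹ * ‖z‖ := by
        simp [norm_smul, norm_conj, norm_e]
    _ ≤ ((‖z‖ ^ 2) ^ 4)⁻¹ + 8 * ‖z‖ * ((‖z‖ ^ 2) ^ 5)⁻¹ * ‖z‖ := by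
        gcongr; exact abs_re_le_norm z
    _ = 9 * (‖z‖ ^ 8)⁻¹ := by field_simp; norm_num

theorem norm_regKernelDeriv_zero_le (z : Octonion) :
    ‖regKernelDeriv 0 z‖ ≤ 9 * (‖z‖ ^ 8)⁻¹ := by
  refine ContinuousLinearMap.opNorm_le_bound _ (by positivity) fun h => ?_
  rw [regKernelDeriv_apply, add_zero]
  rcases eq_or_ne ‖z‖ 0 with hz | hz
  · simp [hz]
  calc _ ≤ ‖((‖z‖ ^ 2) ^ 4)⁻¹ • conj h‖ +
        ‖(8 * ((‖z‖ ^ 2) ^ 5)⁻¹) • inner ℝ z h • conj z‖ := norm_sub_le _ _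
    _ = ((‖z‖ ^ 2) ^ 4)⁻¹ * ‖h‖ + 8 * ((‖z‖ ^ 2) ^ 5)⁻¹ * (|inner ℝ z h| * ‖z‖) := by
        simp [norm_smul, norm_conj]
    _ ≤ ((‖z‖ ^ 2) ^ 4)⁻¹ * ‖h‖ + 8 * ((‖z‖ ^ 2) ^ 5)⁻¹ * (‖z‖ * ‖h‖ * ‖z‖) := by
        gcongr; exact abs_real_inner_le_norm z h
    _ = 9 * (‖z‖ ^ 8)⁻¹ * ‖h‖ := by field_simp; ring

theorem norm_cauchyKernelDeriv₂_le (z : Octonion) :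
    ‖cauchyKernelDeriv₂ z‖ ≤ 104 * (‖z‖ ^ 9)⁻¹ := by
  refine ContinuousLinearMap.opNorm_le_bound _ (by positivity) fun h => ?_
  rw [cauchyKernelDeriv₂_apply]
  rcases eq_or_ne ‖z‖ 0 with hz | hz
  · simp [hz]
  calc _ ≤ ‖(-(8 * ((‖z‖ ^ 2) ^ 5)⁻¹)) • inner ℝ z h • e 0‖
        + ‖(8 * ((‖z‖ ^ 2) ^ 5)⁻¹) • re h • conj z‖
        + ‖(8 * re z * ((‖z‖ ^ 2) ^ 5)⁻¹) • conj h‖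
        + ‖(80 * re z * ((‖z‖ ^ 2) ^ 6)⁻¹) • inner ℝ z h • conj z‖ :=
        (norm_add_le _ _).trans (add_le_add_left
          ((norm_sub_le _ _).trans (add_le_add_left (norm_sub_le _ _) _)) _)
    _ = 8 * ((‖z‖ ^ 2) ^ 5)⁻¹ * |inner ℝ z h| + 8 * ((‖z‖ ^ 2) ^ 5)⁻¹ * (|re h| * ‖z‖)
        + 8 * |re z| * ((‖z‖ ^ 2) ^ 5)⁻¹ * ‖h‖
        + 80 * |re z| * ((‖z‖ ^ 2) ^ 6)⁻¹ * (|inner ℝ z h| * ‖z‖) := by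
        simp [norm_smul, norm_conj, norm_e]
    _ ≤ 8 * ((‖z‖ ^ 2) ^ 5)⁻¹ * (‖z‖ * ‖h‖) + 8 * ((‖z‖ ^ 2) ^ 5)⁻¹ * (‖h‖ * ‖z‖)
        + 8 * ‖z‖ * ((‖z‖ ^ 2) ^ 5)⁻¹ * ‖h‖
        + 80 * ‖z‖ * ((‖z‖ ^ 2) ^ 6)⁻¹ * (‖z‖ * ‖h‖ * ‖z‖) := by
        gcongr
        · exact abs_real_inner_le_norm z h
        · exact abs_re_le_norm h
        · exact abs_re_le_norm z
        · exact abs_re_le_norm z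
        · exact abs_real_inner_le_norm z h
    _ = 104 * (‖z‖ ^ 9)⁻¹ * ‖h‖ := by field_simp; ring

/-- Homogeneity of degree -7 is the source of the factor (π/(2d))⁷ before the cotangent. -/
theorem cauchyKernel_smul (r : ℝ) (hr : 0 < r) (z : Octonion) :
    r ^ 7 • cauchyKernel (r • z) = cauchyKernel z := by
  simp only [cauchyKernel, conj_smul, norm_smul, smul_smul, Real.norm_eq_abs, abs_of_pos hr]
  congr 1
  rw [mul_pow, mul_inv]
  field_simp

/-! ### Stokes' formula for test functions -/

/-- The divergence theorem for compactly supported differentiable vector fields on `ℝ⁸` with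
integrable divergence. -/
theorem integral_divergence_eq_zero (V : Fin 8 → Octonion → Octonion)
    (V' : Fin 8 → Octonion → Octonion →L[ℝ] Octonion)
    (hV : ∀ i z, HasFDerivAt (V i) (V' i z) z) {K : Set Octonion} (hK : IsCompact K)
    (hVK : ∀ i, ∀ z ∉ K, V i z = 0) (hint : Integrable fun z => ∑ i, V' i z (e i)) :
    ∫ z, ∑ i, V' i z (e i) = 0 := by
  obtain ⟨r, hr0, hr⟩ : ∃ r : ℝ, 0 < r ∧ ∀ z ∈ K, ‖z‖ < r := by
    obtain ⟨r, hr⟩ := hK.isBounded.exists_norm_le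
    exact ⟨max r 0 + 1, by positivity, fun z hz =>
      ((hr z hz).trans (le_max_left _ _)).trans_lt (lt_add_one _)⟩
  let eL := EuclideanSpace.equiv (Fin 8) ℝ
  have hvol : MeasurePreserving eL.symm volume volume := PiLp.volume_preserving_toLp (Fin 8)
  have hemb : MeasurableEmbedding eL.symm := eL.symm.toHomeomorph.measurableEmbedding
  have hsingle (i : Fin 8) : eL.symm (Pi.single i 1) = e i := rfl
  have houtside (i : Fin 8) (x : Fin 8 → ℝ) (j : Fin 8) (hx : r ≤ |x j|) :
      V i (eL.symm x) = 0 := by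
    refine hVK i _ fun hxK => ?_
    have h1 := hr _ hxK
    have h2 := PiLp.norm_apply_le (eL.symm x) j
    rw [Real.norm_eq_abs] at h2
    exact hx.not_gt (h2.trans_lt h1)
  have hdiv_outside (z : Octonion) (j : Fin 8) (hz : r < |z j|) (i : Fin 8) : V' i z = 0 := by
    have hev : V i =ᶠ[𝓝 z] fun _ => 0 := by
      have hc : Continuous fun y : Octonion => |y j| := by fun_prop
      filter_upwards [(isOpen_lt continuous_const hc).mem_nhds hz] with y hy
      exact houtside i (eL y) j (le_of_lt hy)
    exact (hV i z).unique ((hasFDerivAt_const (0 : Octonion) z).congr_of_eventuallyEq hev)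
  have hint' : Integrable fun x => ∑ i, V' i (eL.symm x) (e i) :=
    (hvol.integrable_comp_emb hemb).2 hint
  -- On a cube whose faces miss `K`. Pointwise differentiability and an integrable divergence
  -- suffice, so the partial derivatives of a regular function need not be known to be continuous.
  have key := integral_divergence_of_hasFDerivAt_off_countable' (E := Octonion)
    (fun _ : Fin 8 => -r) (fun _ => r) (fun _ => by linarith)
    (fun i x => V i (eL.symm x))
    (fun i x => (V' i (eL.symm x)).comp (eL.symm : (Fin 8 → ℝ) →L[ℝ] Octonion)) ∅
    Set.countable_empty
    (fun i x _ => ((hV i _).comp x eL.symm.hasFDerivAt).continuousAt.continuousWithinAt)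
    (fun x _ i => (hV i _).comp x eL.symm.hasFDerivAt) hint'.integrableOn
  rw [← hvol.integral_comp hemb, ← setIntegral_eq_integral_of_forall_compl_eq_zero
    (s := Set.Icc (fun _ : Fin 8 => -r) (fun _ => r))]
  · refine key.trans (Finset.sum_eq_zero fun i _ => ?_)
    rw [sub_eq_zero]
    trans (0 : Octonion)
    · refine integral_eq_zero_of_ae (Eventually.of_forall fun x => houtside i _ i ?_)
      simp [abs_of_pos hr0]
    · refine (integral_eq_zero_of_ae (Eventually.of_forall fun x => houtside i _ i ?_)).symm
      simp [abs_of_pos hr0]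
  · intro x hx
    obtain ⟨j, hj⟩ : ∃ j, r < |x j| := by
      by_contra! h
      exact hx ⟨fun j => (abs_le.1 (h j)).1, fun j => (abs_le.1 (h j)).2⟩
    exact Finset.sum_eq_zero fun i _ => by rw [hdiv_outside (eL.symm x) j hj]; rfl

/-- The gradient of a scalar function, as an octonion: `∑ᵢ (∂φ/∂xᵢ) eᵢ`. -/
def octGrad (φ : Octonion → ℝ) (z : Octonion) : Octonion := ∑ i, fderiv ℝ φ z (e i) • e i

theorem octGrad_eq_zero_of_notMem_tsupport {φ : Octonion → ℝ} {z : Octonion}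
    (hz : z ∉ tsupport φ) : octGrad φ z = 0 := by
  simp [octGrad, fderiv_of_notMem_tsupport ℝ hz]

theorem continuous_octGrad {φ : Octonion → ℝ} (hφ : ContDiff ℝ 1 φ) : Continuous (octGrad φ) := by
  have := hφ.continuous_fderiv one_ne_zero
  unfold octGrad
  fun_prop

theorem leftSymbol_fderiv_eq_zero {U : Set Octonion} (hU : IsOpen U) {f : Octonion → Octonion}
    (hf : IsLeftRegularOn f U) {z : Octonion} (hz : z ∈ U) : leftSymbol (fderiv ℝ f z) = 0 := by
  have h := (hf.1.differentiableAt (hU.mem_nhds hz)).hasFDerivAt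
  rw [← cauchyRiemann_eq_leftSymbol h, hf.2 z hz]

theorem integrable_of_eq_zero_of_notMem_tsupport {U : Set Octonion} {φ : Octonion → ℝ}
    (hcs : HasCompactSupport φ) (hsub : tsupport φ ⊆ U) {W : Octonion → Octonion}
    (hout : ∀ z ∉ tsupport φ, W z = 0) (hW : ∀ z ∈ U, ContinuousAt W z) : Integrable W := by
  have hWs : tsupport W ⊆ tsupport φ := by
    refine closure_minimal (fun z hz => ?_) (isClosed_tsupport φ)
    by_contra h
    exact hz (hout z h)
  have hWc : Continuous W := continuous_of_tsupport fun z hz => hW z (hsub (hWs hz))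
  exact hWc.integrable_of_hasCompactSupport (hcs.mono' (subset_closure.trans hWs))

/-- Stokes' formula for a left regular function `f`, a scalar test function `φ` and an octonion
valued function `Φ` such that `∑ᵢ (∂Φ/∂xᵢ) (eᵢ x) = κ x` for all `x`. -/
theorem integral_test_function_mul_eq_zero {U : Set Octonion} (hU : IsOpen U)
    {f : Octonion → Octonion} (hf : IsLeftRegularOn f U) {φ : Octonion → ℝ}
    (hφ : ContDiff ℝ 1 φ) (hcs : HasCompactSupport φ) (hsub : tsupport φ ⊆ U)
    {Φ κ : Octonion → Octonion} {Φ' : Octonion → Octonion →L[ℝ] Octonion}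
    (hΦ : ∀ z ∈ U, HasFDerivAt Φ (Φ' z) z)
    (hκ : ∀ z ∈ U, ∀ x, ∑ i, mul (Φ' z (e i)) (mul (e i) x) = mul (κ z) x)
    (hκc : ContinuousOn κ U) :
    Integrable (fun z => φ z • mul (κ z) (f z)) ∧
    Integrable (fun z => mul (Φ z) (mul (octGrad φ z) (f z))) ∧
    ∫ z, φ z • mul (κ z) (f z) = -∫ z, mul (Φ z) (mul (octGrad φ z) (f z)) := by
  have hfc (z : Octonion) (hz : z ∈ U) : ContinuousAt f z :=
    (hf.1.differentiableAt (hU.mem_nhds hz)).continuousAt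
  have hint1 : Integrable (fun z => φ z • mul (κ z) (f z)) := by
    refine integrable_of_eq_zero_of_notMem_tsupport hcs hsub (fun z hz => by simp [image_eq_zero_of_notMem_tsupport hz]) fun z hz => ?_
    have h1 := hfc z hz
    have h2 : ContinuousAt κ z := hκc.continuousAt (hU.mem_nhds hz)
    have h5 : ContinuousAt φ z := hφ.continuous.continuousAt
    simp only [← mulL_apply]
    fun_prop
  have hint2 : Integrable (fun z => mul (Φ z) (mul (octGrad φ z) (f z))) := by
    refine integrable_of_eq_zero_of_notMem_tsupport hcs hsub (fun z hz => ?_) fun z hz => ?_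
    · simp [octGrad_eq_zero_of_notMem_tsupport hz, ← mulL_apply]
    have h1 := hfc z hz
    have h3 : ContinuousAt Φ z := (hΦ z hz).continuousAt
    have h4 : ContinuousAt (octGrad φ) z := (continuous_octGrad hφ).continuousAt
    simp only [← mulL_apply]
    fun_prop
  refine ⟨hint1, hint2, ?_⟩
  rw [eq_neg_iff_add_eq_zero, ← integral_add hint1 hint2]
  set W : Octonion → Octonion :=
    fun z => φ z • mul (κ z) (f z) + mul (Φ z) (mul (octGrad φ z) (f z)) with hW
  have hWint : Integrable W := hint1.add hint2
  have hout (z : Octonion) (hz : z ∉ tsupport φ) : W z = 0 := by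
    simp [hW, image_eq_zero_of_notMem_tsupport hz, octGrad_eq_zero_of_notMem_tsupport hz,
      ← mulL_apply]
  -- The product rule yields three terms in the divergence: the gradient of `φ`, the derivative of
  -- `Φ` (giving `κ`), and `Φ` times ∑ᵢ eᵢ ∂ᵢf, which vanishes by regularity. The bracketing Φ (eᵢ
  -- f) keeps `Φ` outside this last sum.
  let V : Fin 8 → Octonion → Octonion := fun i z => φ z • mul (Φ z) (mul (e i) (f z))
  have hVout (i : Fin 8) (z : Octonion) (hz : z ∉ tsupport φ) : HasFDerivAt (𝕜 := ℝ) (V i) 0 z := by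
    refine (hasFDerivAt_const (0 : Octonion) z).congr_of_eventuallyEq ?_
    filter_upwards [(isClosed_tsupport φ).isOpen_compl.mem_nhds hz] with y hy
    simp [V, image_eq_zero_of_notMem_tsupport hy]
  have hVin (i : Fin 8) (z : Octonion) (hz : z ∈ U) : ∃ L : Octonion →L[ℝ] Octonion, HasFDerivAt (V i) L z ∧
      L (e i) = fderiv ℝ φ z (e i) • mul (Φ z) (mul (e i) (f z)) +
        φ z • (mul (Φ' z (e i)) (mul (e i) (f z)) +
          mul (Φ z) (mul (e i) (fderiv ℝ f z (e i)))) := by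
    have h1 := (hf.1.differentiableAt (hU.mem_nhds hz)).hasFDerivAt
    have h2 : HasFDerivAt (fun y => mul (e i) (f y)) ((mulL (e i)).comp (fderiv ℝ f z)) z :=
      (mulL (e i)).hasFDerivAt.comp z h1
    have h3 := mulL.hasFDerivAt_of_bilinear (hΦ z hz) h2
    have h4 := ((hφ.differentiable one_ne_zero) z).hasFDerivAt.smul h3
    refine ⟨_, h4, ?_⟩
    simp [mulL_apply]
    abel
  have hVd (i : Fin 8) (z : Octonion) : HasFDerivAt (V i) (fderiv ℝ (V i) z) z := by
    by_cases hz : z ∈ tsupport φ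
    · obtain ⟨L, hL, -⟩ := hVin i z (hsub hz)
      exact hL.differentiableAt.hasFDerivAt
    · exact (hVout i z hz).differentiableAt.hasFDerivAt
  have hdiv (z : Octonion) : ∑ i, fderiv ℝ (V i) z (e i) = W z := by
    by_cases hz : z ∈ tsupport φ
    · have hzU := hsub hz
      have h1 (i : Fin 8) : fderiv ℝ (V i) z (e i) =
          fderiv ℝ φ z (e i) • mul (Φ z) (mul (e i) (f z)) +
          φ z • (mul (Φ' z (e i)) (mul (e i) (f z)) +
            mul (Φ z) (mul (e i) (fderiv ℝ f z (e i)))) := by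
        obtain ⟨L, hL, hL'⟩ := hVin i z hzU
        rw [hL.fderiv, hL']
      have h2 := leftSymbol_fderiv_eq_zero hU hf hzU
      simp only [h1, Finset.sum_add_distrib, ← Finset.smul_sum, hκ z hzU, ← mul_sum_right]
      rw [← leftSymbol, h2]
      have h3 : mul (Φ z) 0 = 0 := map_zero (mulL (Φ z))
      have h4 : mul (Φ z) (mul (octGrad φ z) (f z)) =
          ∑ i, fderiv ℝ φ z (e i) • mul (Φ z) (mul (e i) (f z)) := by
        rw [octGrad, mul_sum_left, mul_sum_right]
        simp only [Octonion.smul_mul, Octonion.mul_smul]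
      rw [h3, add_zero, hW]
      simp only [h4]
      abel
    · simp [hout z hz, (hVout _ z hz).fderiv]
  have hfin := integral_divergence_eq_zero V (fun i => fderiv ℝ (V i)) hVd hcs
    (fun i z hz => by simp [V, image_eq_zero_of_notMem_tsupport hz])
    (by simpa only [hdiv] using hWint)
  simpa only [hdiv] using hfin

/-! ### The Cauchy–Pompeiu formula -/

theorem volume_real_ball_zero_one :
    (volume : Measure Octonion).real (Metric.ball 0 1) = Real.pi ^ 4 / 24 := by
  rw [Measure.real, EuclideanSpace.volume_ball]
  have h1 : √Real.pi ^ 8 = Real.pi ^ 4 := by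
    rw [show (8 : ℕ) = 2 * 4 by norm_num, pow_mul, Real.sq_sqrt Real.pi_pos.le]
  have h2 : Real.Gamma ((Fintype.card (Fin 8) : ℝ) / 2 + 1) = 24 := by
    rw [Fintype.card_fin, show ((8 : ℕ) : ℝ) / 2 + 1 = ((4 : ℕ) : ℝ) + 1 by norm_num,
      Real.Gamma_nat_eq_factorial]
    norm_num [Nat.factorial]
  rw [h2, Fintype.card_fin, h1]
  simp only [ENNReal.ofReal_one, one_pow, one_mul]
  exact ENNReal.toReal_ofReal (by positivity)

/-- The antiderivative is (y²/(1 + y²))⁴, written with 1 - (1 + y²)⁻¹; it grows from 0 to 1. -/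
theorem integral_radial_bump :
    ∫ y in Set.Ioi (0 : ℝ), y ^ 7 • (8 * ((1 + y ^ 2) ^ 5)⁻¹) = 1 := by
  have hd (y : ℝ) : HasDerivAt (fun y : ℝ => (1 - (1 + y ^ 2)⁻¹) ^ 4)
      (y ^ 7 • (8 * ((1 + y ^ 2) ^ 5)⁻¹)) y := by
    have h0 : (1 + y ^ 2) ≠ 0 := by positivity
    have h1 := (((((hasDerivAt_pow 2 y).const_add 1).inv h0).const_sub 1).pow 4)
    convert! h1 using 1
    simp only [smul_eq_mul, Pi.inv_apply]
    push_cast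
    field_simp
    ring
  have hlim : Tendsto (fun y : ℝ => (1 - (1 + y ^ 2)⁻¹) ^ 4) atTop (𝓝 1) := by
    have h1 : Tendsto (fun y : ℝ => (1 + y ^ 2)⁻¹) atTop (𝓝 0) :=
      tendsto_inv_atTop_zero.comp
        (tendsto_atTop_add_const_left _ _ (tendsto_pow_atTop two_ne_zero))
    simpa using (h1.const_sub 1).pow 4
  have := integral_Ioi_of_hasDerivAt_of_nonneg' (a := 0) (fun x _ => hd x)
    (fun x hx => by have : (0 : ℝ) < x := hx; positivity) hlim
  rw [this]
  norm_num

/-- The normalized bump `(24 / π⁴) (1 + |z|²)⁻⁵`. -/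
def bump (z : Octonion) : ℝ := 3 / Real.pi ^ 4 * (8 * ((1 + ‖z‖ ^ 2) ^ 5)⁻¹)

/-- In polar coordinates the sphere has area 8 · π⁴/24 = π⁴/3, which cancels the prefactor 3/π⁴. -/
theorem integral_bump : ∫ z, bump z = 1 := by
  have h := integral_fun_norm_addHaar (volume : Measure Octonion)
    (fun y : ℝ => 8 * ((1 + y ^ 2) ^ 5)⁻¹)
  rw [volume_real_ball_zero_one, finrank_euclideanSpace, Fintype.card_fin,
    show 8 - 1 = 7 by norm_num, integral_radial_bump] at h
  unfold bump
  rw [integral_const_mul, h]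
  have := Real.pi_pos
  simp
  field_simp
  norm_num

theorem tendsto_norm_pow_mul_bump :
    Tendsto (fun z : Octonion => ‖z‖ ^ Module.finrank ℝ Octonion * bump z)
      (Bornology.cobounded Octonion) (𝓝 0) := by
  rw [finrank_euclideanSpace, Fintype.card_fin]
  have h1 : Tendsto (fun z : Octonion => (3 / Real.pi ^ 4 * 8) * (1 + ‖z‖)⁻¹)
      (Bornology.cobounded Octonion) (𝓝 0) := by
    rw [← mul_zero (3 / Real.pi ^ 4 * 8)]
    exact (tendsto_inv_atTop_zero.comp
      (tendsto_atTop_add_const_left _ _ tendsto_norm_cobounded_atTop)).const_mul _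
  refine squeeze_zero (fun z => by unfold bump; positivity) (fun z => ?_) h1
  have hz := norm_nonneg z
  rw [bump, show ‖z‖ ^ 8 * (3 / Real.pi ^ 4 * (8 * ((1 + ‖z‖ ^ 2) ^ 5)⁻¹)) =
    3 / Real.pi ^ 4 * 8 * (‖z‖ ^ 8 * ((1 + ‖z‖ ^ 2) ^ 5)⁻¹) by ring]
  refine mul_le_mul_of_nonneg_left ?_ (by positivity)
  rw [← div_eq_mul_inv, ← one_div, div_le_div_iff₀ (by positivity) (by positivity), one_mul]
  have h2 : (1 + ‖z‖) ≤ 2 * (1 + ‖z‖ ^ 2) := by nlinarith [sq_nonneg (‖z‖ - 1)]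
  nlinarith [pow_nonneg hz 2, pow_nonneg hz 4, pow_nonneg hz 6, pow_nonneg hz 8,
    mul_nonneg (pow_nonneg hz 8) (sq_nonneg (‖z‖ - 1))]

/-- The Cauchy-Pompeiu formula for `φ f` with `f` left regular and `φ` a scalar test function
whose gradient vanishes near `w`. -/
theorem cauchyPompeiu {U : Set Octonion} (hU : IsOpen U)
    {f : Octonion → Octonion} (hf : IsLeftRegularOn f U) {φ : Octonion → ℝ}
    (hφ : ContDiff ℝ 1 φ) (hcs : HasCompactSupport φ) (hsub : tsupport φ ⊆ U)
    {w : Octonion} (hw : w ∈ U) {r : ℝ} (hr : 0 < r)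
    (hφw : ∀ z, ‖z - w‖ < r → octGrad φ z = 0) :
    Integrable (fun z => mul (cauchyKernel (z - w)) (mul (octGrad φ z) (f z))) ∧
    ∫ z, mul (cauchyKernel (z - w)) (mul (octGrad φ z) (f z)) =
      -((Real.pi ^ 4 / 3) • φ w • f w) := by
  -- Smoothing the kernel replaces the excision of a ball around `w`: Stokes' formula applies on all
  -- of `U`, and `κ` becomes an approximate identity of mass π⁴/3.
  have hstokes (s : ℝ) (hs : 0 < s) := integral_test_function_mul_eq_zero hU hf hφ hcs hsub
    (Φ := fun z => regKernel s (z - w)) (Φ' := fun z => regKernelDeriv s (z - w))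
    (κ := fun z => (8 * s * ((‖z - w‖ ^ 2 + s) ^ 5)⁻¹) • e 0)
    (fun z _ => by
      have h1 := hasFDerivAt_regKernel s (z - w) (by positivity)
      exact h1.comp z ((hasFDerivAt_id z).sub_const w))
    (fun z _ x => by
      rw [sum_regKernelDeriv_mul s (z - w) x (by positivity), Octonion.smul_mul, e_zero_mul])
    (by
      refine Continuous.continuousOn ?_
      have (z : Octonion) : (‖z - w‖ ^ 2 + s) ^ 5 ≠ 0 := by positivity
      fun_prop (disch := assumption))
  have hφf : Integrable (fun z => φ z • f z) := by
    refine integrable_of_eq_zero_of_notMem_tsupport hcs hsub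
      (fun z hz => by simp [image_eq_zero_of_notMem_tsupport hz]) fun z hz => ?_
    have h1 := (hf.1.differentiableAt (hU.mem_nhds hz)).continuousAt
    have h2 := hφ.continuous.continuousAt (x := z)
    fun_prop
  have hgf : Integrable (fun z => mul (octGrad φ z) (f z)) := by
    refine integrable_of_eq_zero_of_notMem_tsupport hcs hsub (fun z hz => ?_) fun z hz => ?_
    · simp [octGrad_eq_zero_of_notMem_tsupport hz, ← mulL_apply]
    have h1 := (hf.1.differentiableAt (hU.mem_nhds hz)).continuousAt
    have h2 := (continuous_octGrad hφ).continuousAt (x := z)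
    simp only [← mulL_apply]
    fun_prop
  have hpeak := tendsto_integral_comp_smul_smul_of_integrable' (μ := (volume : Measure Octonion))
    (φ := bump) (fun z => by unfold bump; positivity) integral_bump tendsto_norm_pow_mul_bump
    (x₀ := w) hφf (by
      have h1 := (hf.1.differentiableAt (hU.mem_nhds hw)).continuousAt
      have h2 := hφ.continuous.continuousAt (x := w)
      fun_prop)
  -- Uniform in s because the gradient vanishes on the ball of radius `r`, where the kernels blow
  -- up.
  have hbound (s : ℝ) (hs : 0 ≤ s) (z : Octonion) :
      ‖mul (regKernel s (z - w)) (mul (octGrad φ z) (f z))‖ ≤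
        (r ^ 7)⁻¹ * ‖mul (octGrad φ z) (f z)‖ := by
    rcases lt_or_ge ‖z - w‖ r with hz | hz
    · simp [hφw z hz, ← mulL_apply]
    · rw [Octonion.norm_mul]
      have hzw : 0 < ‖z - w‖ := hr.trans_le hz
      have h1 : ‖regKernel s (z - w)‖ ≤ (r ^ 7)⁻¹ :=
        calc ‖regKernel s (z - w)‖ = ((‖z - w‖ ^ 2 + s) ^ 4)⁻¹ * ‖z - w‖ := by
              rw [regKernel, norm_smul, norm_conj, norm_inv, norm_pow,
                Real.norm_of_nonneg (by positivity)]
          _ ≤ ((‖z - w‖ ^ 2) ^ 4)⁻¹ * ‖z - w‖ := by gcongr; linarith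
          _ = (‖z - w‖ ^ 7)⁻¹ := by field_simp
          _ ≤ (r ^ 7)⁻¹ := by gcongr
      gcongr
  have hmeas (s : ℝ) (hs : 0 < s) :
      AEStronglyMeasurable (fun z => mul (regKernel s (z - w)) (mul (octGrad φ z) (f z))) :=
    (hstokes s hs).2.1.aestronglyMeasurable
  have hinvsq : Tendsto (fun c : ℝ => (c ^ 2)⁻¹) atTop (𝓝 0) :=
    tendsto_inv_atTop_zero.comp (tendsto_pow_atTop two_ne_zero)
  have hptw (z : Octonion) : Tendsto (fun c : ℝ =>
      mul (regKernel (c ^ 2)⁻¹ (z - w)) (mul (octGrad φ z) (f z))) atTop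
      (𝓝 (mul (cauchyKernel (z - w)) (mul (octGrad φ z) (f z)))) := by
    rcases lt_or_ge ‖z - w‖ r with hz | hz
    · simp [hφw z hz, ← mulL_apply]
    · have hzw : 0 < ‖z - w‖ := hr.trans_le hz
      rw [← regKernel_zero]
      have h1 : Tendsto (fun c : ℝ => ((‖z - w‖ ^ 2 + (c ^ 2)⁻¹) ^ 4)⁻¹) atTop
          (𝓝 ((‖z - w‖ ^ 2 + 0) ^ 4)⁻¹) :=
        ((hinvsq.const_add _).pow 4).inv₀ (by positivity)
      simp only [regKernel, Octonion.smul_mul]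
      exact h1.smul_const _
  have hlim : Tendsto (fun c : ℝ =>
      ∫ z, mul (regKernel (c ^ 2)⁻¹ (z - w)) (mul (octGrad φ z) (f z))) atTop
      (𝓝 (∫ z, mul (cauchyKernel (z - w)) (mul (octGrad φ z) (f z)))) := by
    refine tendsto_integral_filter_of_dominated_convergence
      (fun z => (r ^ 7)⁻¹ * ‖mul (octGrad φ z) (f z)‖) ?_ ?_ (hgf.norm.const_mul _)
      (Eventually.of_forall hptw)
    · filter_upwards [eventually_gt_atTop 0] with c hc using hmeas _ (by positivity)
    · filter_upwards [eventually_gt_atTop 0] with c hc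
      exact Eventually.of_forall fun z => hbound _ (by positivity) z
  -- With s = c⁻², `κ` is π⁴/3 times the rescaled bump c⁸ · bump(c(w - z)).
  have heq : ∀ᶠ c : ℝ in atTop,
      (Real.pi ^ 4 / 3) • ∫ z, (c ^ Module.finrank ℝ Octonion * bump (c • (w - z))) • φ z • f z =
      -∫ z, mul (regKernel (c ^ 2)⁻¹ (z - w)) (mul (octGrad φ z) (f z)) := by
    filter_upwards [eventually_gt_atTop 0] with c hc
    rw [← (hstokes (c ^ 2)⁻¹ (by positivity)).2.2, ← integral_smul]
    congr 1
    ext1 z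
    rw [Octonion.smul_mul, e_zero_mul, finrank_euclideanSpace, Fintype.card_fin, smul_smul,
      smul_smul, smul_smul, bump, norm_smul, Real.norm_of_nonneg hc.le,
      norm_sub_rev w z]
    have h1 : ‖z - w‖ ^ 2 + (c ^ 2)⁻¹ = (1 + (c * ‖z - w‖) ^ 2) * (c ^ 2)⁻¹ := by
      field_simp
      ring
    rw [h1]
    congr 1
    field_simp
  have hmeas0 : Integrable (fun z => mul (cauchyKernel (z - w)) (mul (octGrad φ z) (f z))) := by
    refine (hgf.norm.const_mul (r ^ 7)⁻¹).mono' ?_ (Eventually.of_forall fun z => ?_)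
    · exact aestronglyMeasurable_of_tendsto_ae (u := atTop)
        (f := fun (n : ℕ) z =>
          mul (regKernel (((n : ℝ) + 1) ^ 2)⁻¹ (z - w)) (mul (octGrad φ z) (f z)))
        (fun n => hmeas _ (by positivity))
        (Eventually.of_forall fun z => (hptw z).comp
          (tendsto_atTop_add_const_right _ _ tendsto_natCast_atTop_atTop))
    · have := hbound 0 le_rfl z
      rwa [regKernel_zero] at this
  refine ⟨hmeas0, ?_⟩
  rw [eq_neg_iff_add_eq_zero, ← neg_eq_iff_add_eq_zero]
  exact tendsto_nhds_unique hlim.neg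
    (((hpeak.const_smul (Real.pi ^ 4 / 3)).congr' heq))

/-! ### Periodization over the lattice 2dℤ -/

/-- The points `u` with `|Re u| ≤ 2d` at distance at least `c` from the lattice `2dℤ`. -/
def awayFromLattice (d c : ℝ) : Set Octonion :=
  {u | |re u| ≤ 2 * d ∧ ∀ n : ℤ, c ≤ ‖u + (2 * d * n) • e 0‖}

/-- A summable weight on `ℤ`. -/
def latticeWeight (n : ℤ) : ℝ := ((1 + |(n : ℝ)|) ^ 2)⁻¹

theorem latticeWeight_nonneg (n : ℤ) : 0 ≤ latticeWeight n := by
  unfold latticeWeight; positivity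

theorem summable_latticeWeight : Summable latticeWeight := by
  have h := (Real.summable_one_div_int_pow (p := 2)).2 one_lt_two
  have h' : Summable fun n : ℤ => 1 / (n : ℝ) ^ 2 + if n = 0 then 1 else 0 :=
    h.add (summable_of_hasFiniteSupport ((Set.finite_singleton 0).subset fun n hn => by
      by_contra h0
      exact hn (if_neg h0)))
  refine Summable.of_nonneg_of_le latticeWeight_nonneg (fun n => ?_) h'
  unfold latticeWeight
  rcases eq_or_ne n 0 with rfl | hn
  · simp
  · have hn' : 0 < |(n : ℝ)| := by simpa using hn
    rw [if_neg hn, add_zero, one_div, ← sq_abs (n : ℝ)]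
    gcongr
    linarith

theorem re_add_smul_e_zero (u : Octonion) (t : ℝ) : re (u + t • e 0) = re u + t := by
  simp [re, e]

/-- The distance r = |u + 2dn| dominates both 1 + |n| and 1 + |u|. Seven of its powers are split as
2 + 5: two make the sum over n converge, five give a decay in u that is square integrable on ℝ⁸. The
remaining k - 7 powers are bounded below by c. -/
theorem inv_norm_pow_le {d c : ℝ} (hd : 0 < d) (hc : 0 < c) {k : ℕ} (hk : 7 ≤ k) :
    ∃ K : ℝ, 0 < K ∧ ∀ u ∈ awayFromLattice d c, ∀ n : ℤ,
      (‖u + (2 * d * n) • e 0‖ ^ k)⁻¹ ≤ K * latticeWeight n * ((1 + ‖u‖) ^ 5)⁻¹ := by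
  -- Chosen so that 1 + |n| ≤ A r and 1 + ‖u‖ ≤ A' r.
  set A : ℝ := 2 / c + 1 / (2 * d) with hA
  set A' : ℝ := 1 / c + 1 + 2 * d * A with hA'
  refine ⟨A ^ 2 * A' ^ 5 / c ^ (k - 7), by positivity, fun u hu n => ?_⟩
  set r := ‖u + (2 * d * n) • e 0‖ with hr
  have hcr : c ≤ r := hu.2 n
  have hr0 : 0 < r := hc.trans_le hcr
  have h1 : 2 * d * |(n : ℝ)| - 2 * d ≤ r := by
    have h2 := abs_re_le_norm (u + (2 * d * n) • e 0)
    rw [re_add_smul_e_zero] at h2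
    have h3 : |2 * d * (n : ℝ)| = 2 * d * |(n : ℝ)| := by
      rw [abs_mul, abs_of_pos (by positivity)]
    have h4 := abs_sub_abs_le_abs_sub (2 * d * (n : ℝ)) (-re u)
    rw [abs_neg, h3, sub_neg_eq_add, add_comm (2 * d * (n : ℝ))] at h4
    linarith [hu.1]
  have hone : 1 ≤ r / c := (one_le_div hc).2 hcr
  have h5 : 1 + |(n : ℝ)| ≤ A * r := by
    have h6 : |(n : ℝ)| ≤ 1 + r / (2 * d) := by
      rw [← sub_le_iff_le_add', le_div_iff₀ (by positivity)]
      linarith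
    have h7 : A * r = 2 * (r / c) + r / (2 * d) := by rw [hA]; ring
    linarith
  have h8 : 1 + ‖u‖ ≤ A' * r := by
    have h9 : ‖u‖ ≤ r + 2 * d * |(n : ℝ)| := by
      have h10 := norm_sub_le (u + (2 * d * n) • e 0) ((2 * d * n) • e 0)
      rw [add_sub_cancel_right, norm_smul, norm_e, mul_one, Real.norm_eq_abs, abs_mul,
        abs_of_pos (by positivity : 0 < 2 * d)] at h10
      exact h10
    have h11 : A' * r = r / c + r + 2 * d * (A * r) := by rw [hA']; ring
    have h12 : 2 * d * |(n : ℝ)| ≤ 2 * d * (A * r) := by gcongr; linarith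
    linarith
  have h13 : (1 + |(n : ℝ)|) ^ 2 * (1 + ‖u‖) ^ 5 ≤ A ^ 2 * A' ^ 5 * r ^ 7 :=
    calc (1 + |(n : ℝ)|) ^ 2 * (1 + ‖u‖) ^ 5 ≤ (A * r) ^ 2 * (A' * r) ^ 5 := by gcongr
      _ = A ^ 2 * A' ^ 5 * r ^ 7 := by ring
  have h14 : c ^ (k - 7) * r ^ 7 ≤ r ^ k :=
    calc c ^ (k - 7) * r ^ 7 ≤ r ^ (k - 7) * r ^ 7 := by gcongr
      _ = r ^ k := by rw [← pow_add, Nat.sub_add_cancel hk]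
  rw [latticeWeight, mul_assoc, ← mul_inv, ← div_eq_mul_inv, le_div_iff₀ (by positivity),
    ← div_eq_inv_mul]
  calc (1 + |(n : ℝ)|) ^ 2 * (1 + ‖u‖) ^ 5 / r ^ k
      ≤ (A ^ 2 * A' ^ 5 * r ^ 7) / (c ^ (k - 7) * r ^ 7) := by gcongr
    _ = A ^ 2 * A' ^ 5 / c ^ (k - 7) := by field_simp

theorem mem_awayFromLattice {d c : ℝ} (hd : 0 < d) (hc : 0 < c) {u : Octonion} (h1 : c ≤ re u)
    (h2 : re u ≤ 2 * d - c) : u ∈ awayFromLattice d c := by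
  refine ⟨abs_le.2 ⟨by linarith, by linarith⟩, fun n => ?_⟩
  refine le_trans ?_ (abs_re_le_norm _)
  rw [re_add_smul_e_zero]
  rcases le_or_gt 0 n with hn | hn
  · have : (0 : ℝ) ≤ n := by exact_mod_cast hn
    rw [le_abs]
    left
    nlinarith
  · have : (n : ℝ) ≤ -1 := by exact_mod_cast Int.le_sub_one_of_lt hn
    rw [le_abs]
    right
    nlinarith

variable {F : Type*} [NormedAddCommGroup F]

theorem norm_shift_le {d c : ℝ} (hd : 0 < d) (hc : 0 < c) {k : ℕ} (hk : 7 ≤ k) {C : ℝ}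
    {g : Octonion → F} (hg : ∀ u, ‖g u‖ ≤ C * (‖u‖ ^ k)⁻¹) :
    ∃ K : ℝ, 0 < K ∧ ∀ u ∈ awayFromLattice d c, ∀ n : ℤ,
      ‖g (u + (2 * d * n) • e 0)‖ ≤ K * latticeWeight n * ((1 + ‖u‖) ^ 5)⁻¹ := by
  obtain ⟨K, hK, h⟩ := inv_norm_pow_le hd hc hk
  refine ⟨(|C| + 1) * K, by positivity, fun u hu n => (hg _).trans ?_⟩
  have h1 := h u hu n
  calc C * (‖u + (2 * d * n) • e 0‖ ^ k)⁻¹ ≤ (|C| + 1) * (‖u + (2 * d * n) • e 0‖ ^ k)⁻¹ := by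
        gcongr
        linarith [le_abs_self C]
    _ ≤ (|C| + 1) * (K * latticeWeight n * ((1 + ‖u‖) ^ 5)⁻¹) := by gcongr
    _ = _ := by ring

theorem norm_shift_le' {d c : ℝ} (hd : 0 < d) (hc : 0 < c) {k : ℕ} (hk : 7 ≤ k) {C : ℝ}
    {g : Octonion → F} (hg : ∀ u, ‖g u‖ ≤ C * (‖u‖ ^ k)⁻¹) :
    ∃ K : ℝ, 0 < K ∧ ∀ u ∈ awayFromLattice d c, ∀ n : ℤ,
      ‖g (u + (2 * d * n) • e 0)‖ ≤ K * latticeWeight n := by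
  obtain ⟨K, hK, h⟩ := norm_shift_le hd hc hk hg
  refine ⟨K, hK, fun u hu n => (h u hu n).trans ?_⟩
  refine mul_le_of_le_one_right (mul_nonneg hK.le (latticeWeight_nonneg n)) ?_
  exact inv_le_one_of_one_le₀ (one_le_pow₀ (by linarith [norm_nonneg u]))

theorem summable_shift [CompleteSpace F] {d c : ℝ} (hd : 0 < d) (hc : 0 < c) {k : ℕ} (hk : 7 ≤ k)
    {C : ℝ} {g : Octonion → F} (hg : ∀ u, ‖g u‖ ≤ C * (‖u‖ ^ k)⁻¹) {u : Octonion}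
    (hu : u ∈ awayFromLattice d c) : Summable fun n : ℤ => g (u + (2 * d * n) • e 0) := by
  obtain ⟨K, hK, h⟩ := norm_shift_le' hd hc hk hg
  exact .of_norm_bounded (summable_latticeWeight.mul_left K) (h u hu)

theorem norm_tsum_shift_le {d c : ℝ} (hd : 0 < d) (hc : 0 < c) {k : ℕ} (hk : 7 ≤ k) {C : ℝ}
    {g : Octonion → F} (hg : ∀ u, ‖g u‖ ≤ C * (‖u‖ ^ k)⁻¹) :
    ∃ K : ℝ, 0 < K ∧ ∀ u ∈ awayFromLattice d c,
      ‖∑' n : ℤ, g (u + (2 * d * n) • e 0)‖ ≤ K * ((1 + ‖u‖) ^ 5)⁻¹ := by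
  obtain ⟨K, hK, h⟩ := norm_shift_le hd hc hk hg
  have hs : 0 ≤ ∑' n, latticeWeight n := tsum_nonneg latticeWeight_nonneg
  refine ⟨K * ((∑' n, latticeWeight n) + 1), by positivity, fun u hu => ?_⟩
  have h1 : HasSum (fun n => K * latticeWeight n * ((1 + ‖u‖) ^ 5)⁻¹)
      (K * (∑' n, latticeWeight n) * ((1 + ‖u‖) ^ 5)⁻¹) :=
    (summable_latticeWeight.hasSum.mul_left K).mul_right _
  refine (tsum_of_norm_bounded h1 (h u hu)).trans ?_
  gcongr
  linarith

/-- Termwise differentiation on the slab c < Re y < 2d - c, which is convex, hence connected, and on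
which the derivatives are dominated uniformly by a summable weight. -/
theorem hasFDerivAt_tsum_shift {d c : ℝ} (hd : 0 < d) (hc : 0 < c) {g : Octonion → Octonion}
    {g' : Octonion → Octonion →L[ℝ] Octonion} (hgd : ∀ u ≠ 0, HasFDerivAt g (g' u) u)
    {k k' : ℕ} (hk : 7 ≤ k) (hk' : 7 ≤ k') {C C' : ℝ} (hg : ∀ u, ‖g u‖ ≤ C * (‖u‖ ^ k)⁻¹)
    (hg' : ∀ u, ‖g' u‖ ≤ C' * (‖u‖ ^ k')⁻¹) {u : Octonion} (h1 : c < re u)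
    (h2 : re u < 2 * d - c) :
    HasFDerivAt (fun y => ∑' n : ℤ, g (y + (2 * d * n) • e 0))
      (∑' n : ℤ, g' (u + (2 * d * n) • e 0)) u := by
  obtain ⟨K, hK, h⟩ := norm_shift_le' hd hc hk' hg'
  have hre : Continuous re := by unfold re; fun_prop
  let s : Set Octonion := {y | c < re y ∧ re y < 2 * d - c}
  have hs : IsOpen s := (isOpen_lt continuous_const hre).inter (isOpen_lt hre continuous_const)
  have hconv : Convex ℝ s := by
    have hl : IsLinearMap ℝ re := ⟨fun _ _ => rfl, fun _ _ => rfl⟩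
    exact (convex_halfSpace_gt hl c).inter (convex_halfSpace_lt hl _)
  have hsub (y : Octonion) (hy : y ∈ s) : y ∈ awayFromLattice d c :=
    mem_awayFromLattice hd hc hy.1.le hy.2.le
  have hu : u ∈ s := ⟨h1, h2⟩
  refine hasFDerivAt_tsum_of_isPreconnected (summable_latticeWeight.mul_left K) hs
    hconv.isPreconnected (fun n y hy => ?_) (fun n y hy => h y (hsub y hy) n) hu
    (summable_shift hd hc hk hg (hsub u hu)) hu
  have hne : y + (2 * d * n) • e 0 ≠ 0 := fun h0 => by
    have := (hsub y hy).2 n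
    rw [h0, norm_zero] at this
    exact hc.not_ge this
  exact (hgd _ hne).comp y ((hasFDerivAt_id y).add_const _)

/-- The periodized Cauchy kernel `∑ₙ q₀(u + 2dn)`. -/
def periodicKernel (d : ℝ) (u : Octonion) : Octonion :=
  ∑' n : ℤ, cauchyKernel (u + (2 * d * n) • e 0)

/-- The periodized derivative `∑ₙ (∂q₀/∂x₀)(u + 2dn)` of the Cauchy kernel. -/
def periodicKernelDeriv (d : ℝ) (u : Octonion) : Octonion :=
  ∑' n : ℤ, cauchyKernelDeriv (u + (2 * d * n) • e 0)

theorem hasFDerivAt_cauchyKernel {u : Octonion} (hu : u ≠ 0) :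
    HasFDerivAt cauchyKernel (regKernelDeriv 0 u) u := by
  rw [← regKernel_zero]
  exact hasFDerivAt_regKernel 0 u (by simpa using hu)

theorem norm_cauchyKernel_le (u : Octonion) : ‖cauchyKernel u‖ ≤ 1 * (‖u‖ ^ 7)⁻¹ := by
  rw [one_mul, norm_cauchyKernel]

theorem exists_margin {d : ℝ} {u : Octonion} (h1 : 0 < re u) (h2 : re u < 2 * d) :
    ∃ c > 0, c < re u ∧ re u < 2 * d - c := by
  refine ⟨min (re u) (2 * d - re u) / 2, by
    have : 0 < min (re u) (2 * d - re u) := lt_min h1 (by linarith)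
    positivity, ?_, ?_⟩
  · linarith [min_le_left (re u) (2 * d - re u)]
  · linarith [min_le_right (re u) (2 * d - re u)]

theorem hasFDerivAt_periodicKernel {d : ℝ} (hd : 0 < d) {u : Octonion} (h1 : 0 < re u)
    (h2 : re u < 2 * d) : ∃ L : Octonion →L[ℝ] Octonion, HasFDerivAt (periodicKernel d) L u ∧
      L (e 0) = periodicKernelDeriv d u := by
  obtain ⟨c, hc, hc1, hc2⟩ := exists_margin h1 h2
  refine ⟨_, hasFDerivAt_tsum_shift hd hc (fun u hu => hasFDerivAt_cauchyKernel hu) le_rfl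
    (by norm_num) norm_cauchyKernel_le norm_regKernelDeriv_zero_le hc1 hc2, ?_⟩
  have hs : Summable fun n : ℤ => regKernelDeriv 0 (u + (2 * d * n) • e 0) :=
    summable_shift hd hc (by norm_num) norm_regKernelDeriv_zero_le
      (mem_awayFromLattice hd hc hc1.le hc2.le)
  rw [periodicKernelDeriv]
  simp only [← regKernelDeriv_zero_e_zero]
  exact ((ContinuousLinearMap.apply ℝ Octonion (e 0)).map_tsum hs)

theorem leftSymbol_tsum_eq_zero {ι : Type*} {T : ι → Octonion →L[ℝ] Octonion} (hT : Summable T)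
    (h0 : ∀ n, leftSymbol (T n) = 0) : leftSymbol (∑' n, T n) = 0 := by
  have h (i : Fin 8) : HasSum (fun n => mul (e i) (T n (e i))) (mul (e i) ((∑' n, T n) (e i))) :=
    (mulL (e i)).hasSum ((ContinuousLinearMap.apply ℝ Octonion (e i)).hasSum hT.hasSum)
  have h' := hasSum_sum fun i (_ : i ∈ Finset.univ) => h i
  simp only [leftSymbol] at h0
  simp only [h0] at h'
  exact h'.unique hasSum_zero

theorem hasFDerivAt_periodicKernelDeriv {d : ℝ} (hd : 0 < d) {u : Octonion} (h1 : 0 < re u)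
    (h2 : re u < 2 * d) : ∃ L : Octonion →L[ℝ] Octonion, HasFDerivAt (periodicKernelDeriv d) L u ∧
      leftSymbol L = 0 := by
  obtain ⟨c, hc, hc1, hc2⟩ := exists_margin h1 h2
  refine ⟨_, hasFDerivAt_tsum_shift hd hc (fun u hu => hasFDerivAt_cauchyKernelDeriv u hu)
    (by norm_num) (by norm_num) norm_cauchyKernelDeriv_le norm_cauchyKernelDeriv₂_le hc1 hc2, ?_⟩
  have haway := mem_awayFromLattice hd hc hc1.le hc2.le
  have hs : Summable fun n : ℤ => cauchyKernelDeriv₂ (u + (2 * d * n) • e 0) :=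
    summable_shift hd hc (by norm_num) norm_cauchyKernelDeriv₂_le haway
  refine leftSymbol_tsum_eq_zero hs fun n => leftSymbol_cauchyKernelDeriv₂ _ fun h0 => ?_
  have := haway.2 n
  rw [h0, norm_zero] at this
  exact hc.not_ge this

theorem cauchyKernel_neg (u : Octonion) : cauchyKernel (-u) = -cauchyKernel u := by
  simp [cauchyKernel, conj_neg]

theorem periodicKernel_neg (d : ℝ) (u : Octonion) :
    periodicKernel d (-u) = -periodicKernel d u := by
  rw [periodicKernel, periodicKernel, ← tsum_neg, ← (Equiv.neg ℤ).tsum_eq]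
  congr 1
  ext1 n
  rw [← cauchyKernel_neg]
  congr 1
  simp
  abel

theorem periodicKernel_add (d : ℝ) (u : Octonion) :
    periodicKernel d (u + (2 * d) • e 0) = periodicKernel d u := by
  rw [periodicKernel, periodicKernel, ← (Equiv.addRight (1 : ℤ)).tsum_eq (fun n : ℤ =>
    cauchyKernel (u + (2 * d * n) • e 0))]
  congr 1
  ext1 n
  congr 1
  simp
  module

/-- From 1 + ‖a‖ ≤ (1 + t)(1 + ‖b‖); it transfers the decay from a shifted or reflected argument
back to z. -/
theorem weight_le {a b : Octonion} {t : ℝ} (ht : 0 ≤ t) (h : ‖a‖ ≤ ‖b‖ + t) :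
    ((1 + ‖b‖) ^ 5)⁻¹ ≤ (1 + t) ^ 5 * ((1 + ‖a‖) ^ 5)⁻¹ := by
  rw [← div_eq_mul_inv, ← one_div, div_le_div_iff₀ (by positivity) (by positivity), one_mul,
    ← mul_pow]
  gcongr
  nlinarith [norm_nonneg b, mul_nonneg ht (norm_nonneg b)]

/-- The difference of values of the periodized kernel at points symmetric about `Re u = τ`. -/
theorem norm_periodicKernel_sub_le {d τ : ℝ} (hτ : 0 < τ) (hτd : τ < d) :
    ∃ C : ℝ, 0 < C ∧ ∀ (u : Octonion) (y : ℝ), re u = τ - y → 0 ≤ y → y ≤ τ / 2 →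
      ‖periodicKernel d (u + (2 * y) • e 0) - periodicKernel d u‖ ≤
        C * y * ((1 + ‖u‖) ^ 5)⁻¹ := by
  have hd : 0 < d := hτ.trans hτd
  -- The segment joining the two points stays in τ/2 ≤ Re ≤ 3τ/2, inside the slab with margin τ/2
  -- because τ < d. The mean value inequality over its length 2y then gives the factor y.
  have hc : 0 < τ / 2 := by positivity
  obtain ⟨K, hK, h⟩ := norm_tsum_shift_le hd hc (by norm_num) norm_cauchyKernelDeriv_le
  refine ⟨2 * (K * (1 + d) ^ 5), by positivity, fun u y hu hy0 hy => ?_⟩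
  have hre (t : ℝ) : re (u + t • e 0) = τ - y + t := by rw [re_add_smul_e_zero, hu]
  have hder (t : ℝ) (ht : t ∈ Set.Icc 0 (2 * y)) :
      HasDerivWithinAt (fun t : ℝ => periodicKernel d (u + t • e 0))
        (periodicKernelDeriv d (u + t • e 0)) (Set.Icc 0 (2 * y)) t := by
    obtain ⟨L, hL, hL'⟩ := hasFDerivAt_periodicKernel hd (u := u + t • e 0)
      (by rw [hre]; linarith [ht.1]) (by rw [hre]; linarith [ht.2])
    rw [← hL']
    have h2 : HasDerivAt (fun t : ℝ => u + t • e 0) (e 0) t := by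
      simpa using ((hasDerivAt_id t).smul_const (e 0)).const_add u
    exact (hL.comp_hasDerivAt t h2).hasDerivWithinAt
  have hb (t : ℝ) (ht : t ∈ Set.Ico 0 (2 * y)) :
      ‖periodicKernelDeriv d (u + t • e 0)‖ ≤ K * (1 + d) ^ 5 * ((1 + ‖u‖) ^ 5)⁻¹ := by
    refine (h _ (mem_awayFromLattice hd hc (by rw [hre]; linarith [ht.1])
      (by rw [hre]; linarith [ht.2]))).trans ?_
    rw [mul_assoc]
    refine mul_le_mul_of_nonneg_left (weight_le hd.le ?_) hK.le
    have h3 := norm_sub_le (u + t • e 0) (t • e 0)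
    rw [add_sub_cancel_right, norm_smul, norm_e, mul_one, Real.norm_of_nonneg ht.1] at h3
    linarith [ht.2]
  have := norm_image_sub_le_of_norm_deriv_le_segment' hder hb (2 * y)
    ⟨by positivity, le_rfl⟩
  simp only [zero_smul, add_zero, sub_zero] at this
  refine this.trans (le_of_eq ?_)
  ring

/-! ### The image difference and its boundary decay -/

theorem continuous_re : Continuous re := by unfold re; fun_prop

theorem isOpen_strip (d : ℝ) : IsOpen (strip d) :=
  (isOpen_lt continuous_const continuous_re).inter (isOpen_lt continuous_re continuous_const)

theorem re_conj (z : Octonion) : re (conj z) = re z := by simp [re, conj]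

theorem re_sub (a b : Octonion) : re (a - b) = re a - re b := rfl

theorem conj_eq (z : Octonion) : conj z = (2 * re z) • e 0 - z := by
  ext i; fin_cases i <;> simp [conj, re, e]; ring

/-- The difference between the periodized Cauchy kernel with pole `w` and its reflection; it
vanishes on the boundary of the strip. -/
def stripDiff (d : ℝ) (w z : Octonion) : Octonion :=
  periodicKernel d (conj z + w) - periodicKernel d (w - z)

theorem conj_add_mem_awayFromLattice {d : ℝ} (hd : 0 < d) {w : Octonion} (hw : w ∈ strip d) :
    ∃ c > 0, ∀ z ∈ strip d, conj z + w ∈ awayFromLattice d c := by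
  refine ⟨min (re w) (d - re w), lt_min hw.1 (by linarith [hw.2]), fun z hz => ?_⟩
  have h1 := min_le_left (re w) (d - re w)
  have h2 := min_le_right (re w) (d - re w)
  refine mem_awayFromLattice hd (lt_min hw.1 (by linarith [hw.2])) ?_ ?_ <;>
  rw [re_add, re_conj] <;> linarith [hz.1, hz.2]

/-- Since |Re (w - z)| < d, every lattice translate with n ≠ 0 has norm at least d; only n = 0 needs
the distance from w. -/
theorem sub_mem_awayFromLattice {d r : ℝ} (hd : 0 < d) {w z : Octonion} (hw : w ∈ strip d)
    (hz : z ∈ strip d) (hr : r ≤ ‖z - w‖) : w - z ∈ awayFromLattice d (min r d) := by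
  refine ⟨?_, fun n => ?_⟩
  · rw [re_sub, abs_le]
    constructor <;> linarith [hz.1, hz.2, hw.1, hw.2]
  · rcases lt_trichotomy n 0 with hn | rfl | hn
    · refine (min_le_right r d).trans (le_trans ?_ (abs_re_le_norm _))
      have : (n : ℝ) ≤ -1 := by exact_mod_cast Int.le_sub_one_of_lt hn
      rw [re_add_smul_e_zero, re_sub, le_abs]
      right
      nlinarith [hz.1, hz.2, hw.1, hw.2]
    · simp only [Int.cast_zero, mul_zero, zero_smul, add_zero]
      rw [norm_sub_rev]
      exact (min_le_left r d).trans hr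
    · refine (min_le_right r d).trans (le_trans ?_ (abs_re_le_norm _))
      have : (1 : ℝ) ≤ n := by exact_mod_cast hn
      rw [re_add_smul_e_zero, re_sub, le_abs]
      left
      nlinarith [hz.1, hz.2, hw.1, hw.2]

/-- First-order vanishing at both sides of the strip, together with decay at infinity: exactly what
compensates the gradients of the cutoffs. Each of the three regions uses one summand of the
constant. -/
theorem norm_stripDiff_le {d r : ℝ} (hd : 0 < d) (hr : 0 < r) {w : Octonion}
    (hw : w ∈ strip d) : ∃ C : ℝ, 0 < C ∧ ∀ z ∈ strip d, r ≤ ‖z - w‖ →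
      ‖stripDiff d w z‖ ≤ C * (re z * (d - re z)) * ((1 + ‖z‖) ^ 5)⁻¹ := by
  have hdw : 0 < d - re w := by linarith [hw.2]
  have hw0 : 0 < re w := hw.1
  obtain ⟨C₁, hC₁, h₁⟩ := norm_periodicKernel_sub_le hw0 hw.2
  obtain ⟨C₂, hC₂, h₂⟩ := norm_periodicKernel_sub_le (d := d) hdw (by linarith)
  obtain ⟨c, hc, hcz⟩ := conj_add_mem_awayFromLattice hd hw
  obtain ⟨K₁, hK₁, h₃⟩ := norm_tsum_shift_le hd hc le_rfl norm_cauchyKernel_le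
  obtain ⟨K₂, hK₂, h₄⟩ := norm_tsum_shift_le hd (lt_min hr hd) le_rfl norm_cauchyKernel_le
  set M := (1 + ‖w‖) ^ 5 with hM
  have hM0 : 0 < M := by positivity
  refine ⟨C₁ * M * (2 / d) + C₂ * M * (2 / d) +
    (K₁ + K₂) * M * (2 / re w * (2 / (d - re w))), by positivity, fun z hz hzr => ?_⟩
  have hz0 : 0 < re z := hz.1
  have hzd : 0 < d - re z := by linarith [hz.2]
  have hconj : conj z + w = (w - z) + (2 * re z) • e 0 := by rw [conj_eq]; abel
  have hwt (u : Octonion) (hu : ‖z‖ ≤ ‖u‖ + ‖w‖) :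
      ((1 + ‖u‖) ^ 5)⁻¹ ≤ M * ((1 + ‖z‖) ^ 5)⁻¹ := weight_le (norm_nonneg w) hu
  have hu1 : ‖z‖ ≤ ‖w - z‖ + ‖w‖ := by
    have := norm_sub_le w (w - z)
    rw [sub_sub_cancel] at this
    linarith
  have hu2 : ‖z‖ ≤ ‖z - w‖ + ‖w‖ := by rwa [norm_sub_rev w z] at hu1
  have hu3 : ‖z‖ ≤ ‖conj z + w‖ + ‖w‖ := by
    have := norm_sub_le (conj z + w) w
    rwa [add_sub_cancel_right, norm_conj] at this
  set W := ((1 + ‖z‖) ^ 5)⁻¹ with hW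
  have hW0 : 0 < W := by positivity
  have hP1 : 0 ≤ C₁ * M * (2 / d) * (re z * (d - re z)) * W := by positivity
  have hP2 : 0 ≤ C₂ * M * (2 / d) * (re z * (d - re z)) * W := by positivity
  have hP3 : 0 ≤ (K₁ + K₂) * M * (2 / re w * (2 / (d - re w))) * (re z * (d - re z)) * W := by
    positivity
  have hsplit : (C₁ * M * (2 / d) + C₂ * M * (2 / d) +
    (K₁ + K₂) * M * (2 / re w * (2 / (d - re w)))) * (re z * (d - re z)) * W =
    C₁ * M * (2 / d) * (re z * (d - re z)) * W + C₂ * M * (2 / d) * (re z * (d - re z)) * W +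
    (K₁ + K₂) * M * (2 / re w * (2 / (d - re w))) * (re z * (d - re z)) * W := by ring
  rw [hsplit]
  -- Near Re z = 0: the arguments w - z and conj z + w are symmetric about Re = Re w, at real
  -- distance Re z from it.
  rcases le_or_gt (re z) (re w / 2) with hzw | hzw
  · have h5 := h₁ (w - z) (re z) (re_sub w z) hz0.le hzw
    rw [← hconj] at h5
    have h6 : 1 ≤ 2 / d * (d - re z) := by
      rw [div_mul_eq_mul_div, one_le_div hd]
      linarith [hw.2]
    have h7 : ‖stripDiff d w z‖ ≤ C₁ * M * (2 / d) * (re z * (d - re z)) * W :=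
      calc ‖stripDiff d w z‖ ≤ C₁ * re z * ((1 + ‖w - z‖) ^ 5)⁻¹ := h5
        _ ≤ C₁ * re z * (M * W) := by gcongr; exact hwt _ hu1
        _ ≤ C₁ * re z * (M * W) * (2 / d * (d - re z)) :=
          le_mul_of_one_le_right (by positivity) h6
        _ = _ := by ring
    linarith
  -- Near Re z = d: oddness and 2d-periodicity turn the arguments into z - w and z - w + 2(d - Re
  -- z), symmetric about Re = d - Re w.
  rcases le_or_gt (d - re z) ((d - re w) / 2) with hzw' | hzw'
  · have h5 := h₂ (z - w) (d - re z) (by rw [re_sub]; ring) hzd.le hzw'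
    have h8 : stripDiff d w z =
        -(periodicKernel d (z - w + (2 * (d - re z)) • e 0) - periodicKernel d (z - w)) := by
      have h9 : z - w + (2 * (d - re z)) • e 0 = -(conj z + w) + (2 * d) • e 0 := by
        rw [conj_eq]; module
      rw [h9, periodicKernel_add, periodicKernel_neg, ← neg_sub w z, periodicKernel_neg, stripDiff]
      abel
    have h6 : 1 ≤ 2 / d * re z := by
      rw [div_mul_eq_mul_div, one_le_div hd]
      linarith
    have h7 : ‖stripDiff d w z‖ ≤ C₂ * M * (2 / d) * (re z * (d - re z)) * W :=
      calc ‖stripDiff d w z‖ ≤ C₂ * (d - re z) * ((1 + ‖z - w‖) ^ 5)⁻¹ := by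
            rw [h8, norm_neg]; exact h5
        _ ≤ C₂ * (d - re z) * (M * W) := by gcongr; exact hwt _ hu2
        _ ≤ C₂ * (d - re z) * (M * W) * (2 / d * re z) :=
          le_mul_of_one_le_right (by positivity) h6
        _ = _ := by ring
    linarith
  -- In the middle both distances to the boundary are bounded below, so separate bounds on the two
  -- kernels suffice.
  · have h6 : 1 ≤ 2 / re w * re z := by
      rw [div_mul_eq_mul_div, one_le_div hw0]
      linarith
    have h6' : 1 ≤ 2 / (d - re w) * (d - re z) := by
      rw [div_mul_eq_mul_div, one_le_div hdw]
      linarith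
    have h7 : ‖stripDiff d w z‖ ≤
        (K₁ + K₂) * M * (2 / re w * (2 / (d - re w))) * (re z * (d - re z)) * W :=
      calc ‖stripDiff d w z‖ ≤ K₁ * ((1 + ‖conj z + w‖) ^ 5)⁻¹ + K₂ * ((1 + ‖w - z‖) ^ 5)⁻¹ :=
            (norm_sub_le _ _).trans (add_le_add (h₃ _ (hcz z hz))
              (h₄ _ (sub_mem_awayFromLattice hd hw hz hzr)))
        _ ≤ K₁ * (M * W) + K₂ * (M * W) := by
            gcongr
            · exact hwt _ hu3
            · exact hwt _ hu1
        _ = (K₁ + K₂) * M * W := by ring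
        _ ≤ (K₁ + K₂) * M * W * ((2 / re w * re z) * (2 / (d - re w) * (d - re z))) :=
          le_mul_of_one_le_right (by positivity) (one_le_mul_of_one_le_of_one_le h6 h6')
        _ = _ := by ring
    linarith

/-! ### Stokes' identity summed over the lattice -/

theorem integrable_tsum_of_norm_le {α : Type*} [MeasurableSpace α] {μ : Measure α}
    {E : ℤ → α → Octonion} {b : ℤ → ℝ} {H : α → ℝ} (hE : ∀ n, Integrable (E n) μ)
    (hb : Summable b) (hH : Integrable H μ) (hEb : ∀ n z, ‖E n z‖ ≤ b n * H z) :
    Integrable (fun z => ∑' n, E n z) μ ∧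
    HasSum (fun n => ∫ z, E n z ∂μ) (∫ z, ∑' n, E n z ∂μ) := by
  have hsum (z : α) : Summable fun n => E n z :=
    .of_norm_bounded (hb.mul_right (H z)) fun n => hEb n z
  constructor
  · refine (hH.const_mul (∑' n, b n)).mono' ?_ (Eventually.of_forall fun z =>
      tsum_of_norm_bounded (hb.hasSum.mul_right (H z)) fun n => hEb n z)
    refine aestronglyMeasurable_of_tendsto_ae (u := atTop)
      (f := fun (s : Finset ℤ) z => ∑ n ∈ s, E n z)
      (fun s => Finset.aestronglyMeasurable_fun_sum s fun n _ => (hE n).aestronglyMeasurable)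
      (Eventually.of_forall fun z => (hsum z).hasSum)
  · refine hasSum_integral_of_summable_integral_norm hE
      (Summable.of_nonneg_of_le (fun n => integral_nonneg fun z => norm_nonneg _) (fun n => ?_)
        (hb.mul_right (∫ z, H z ∂μ)))
    rw [← integral_const_mul]
    exact integral_mono (hE n).norm (hH.const_mul _) (hEb n)

protected theorem zero_mul (a : Octonion) : mul 0 a = 0 := by simp [← mulL_apply]

/-- The Bergman kernel integrand up to sign, `2 ∑ₙ (∂q₀/∂x₀)(conj z + w + 2dn) f(z)`. -/
def stripIntegrand (d : ℝ) (w : Octonion) (f : Octonion → Octonion) (z : Octonion) : Octonion :=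
  mul ((2 : ℝ) • periodicKernelDeriv d (conj z + w)) (f z)

theorem conj_add_ne_zero {d : ℝ} (hd : 0 < d) {w z : Octonion} (hw : w ∈ strip d)
    (hz : z ∈ strip d) (n : ℤ) : conj z + w + (2 * d * n) • e 0 ≠ 0 := by
  obtain ⟨c, hc, h⟩ := conj_add_mem_awayFromLattice hd hw
  intro h0
  have := (h z hz).2 n
  rw [h0, norm_zero] at this
  exact hc.not_ge this

theorem sub_add_ne_zero {d : ℝ} (hd : 0 < d) {w z : Octonion} (hw : w ∈ strip d)
    (hz : z ∈ strip d) {n : ℤ} (hn : n ≠ 0) : w - z + (2 * d * n) • e 0 ≠ 0 := by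
  intro h0
  have h1 : re (w - z + (2 * d * n) • e 0) = 0 := by rw [h0]; simp [re]
  rw [re_add_smul_e_zero, re_sub] at h1
  rcases lt_or_gt_of_ne hn with hn | hn
  · have : (n : ℝ) ≤ -1 := by exact_mod_cast Int.le_sub_one_of_lt hn
    nlinarith [hz.1, hz.2, hw.1, hw.2]
  · have : (1 : ℝ) ≤ n := by exact_mod_cast hn
    nlinarith [hz.1, hz.2, hw.1, hw.2]

/-- Conjugation fixes e₀ and negates e₁, …, e₇. As the sum without conjugation is zero, the seven
negated terms contribute the e₀ term once more. -/
theorem sum_regKernelDeriv_conj_mul {v : Octonion} (hv : v ≠ 0) (x : Octonion) :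
    ∑ i, mul (regKernelDeriv 0 v (conj (e i))) (mul (e i) x) =
      mul ((2 : ℝ) • cauchyKernelDeriv v) x := by
  have h1 := sum_regKernelDeriv_mul 0 v x (by simpa using hv)
  rw [Fin.sum_univ_succ] at h1 ⊢
  simp only [mul_zero, zero_mul, zero_smul] at h1
  simp only [conj_e_succ, conj_e_zero, map_neg, Octonion.neg_mul, Finset.sum_neg_distrib]
  rw [eq_neg_of_add_eq_zero_right h1, neg_neg, regKernelDeriv_zero_e_zero, e_zero_mul,
    Octonion.smul_mul, two_smul]

theorem continuousOn_cauchyKernelDeriv : ContinuousOn cauchyKernelDeriv {0}ᶜ := fun u hu =>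
  (hasFDerivAt_cauchyKernelDeriv u hu).continuousAt.continuousWithinAt

/-- The summed Stokes identity for test functions on the strip. -/
theorem integral_test_function_strip {d : ℝ} (hd : 0 < d) {w : Octonion} (hw : w ∈ strip d)
    {f : Octonion → Octonion} (hf : IsLeftRegularOn f (strip d)) {φ : Octonion → ℝ}
    (hφ : ContDiff ℝ 1 φ) (hcs : HasCompactSupport φ) (hsub : tsupport φ ⊆ strip d)
    {r : ℝ} (hr : 0 < r) (hφw : ∀ z, ‖z - w‖ < r → octGrad φ z = 0) :
    Integrable (fun z =>
      φ z • stripIntegrand d w f z + mul (stripDiff d w z) (mul (octGrad φ z) (f z))) ∧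
    ∫ z, (φ z • stripIntegrand d w f z + mul (stripDiff d w z) (mul (octGrad φ z) (f z))) =
      -((Real.pi ^ 4 / 3) • φ w • f w) := by
  have hU := isOpen_strip d
  let v : ℤ → Octonion → Octonion := fun n z => conj z + w + (2 * d * n) • e 0
  let p : ℤ → Octonion → Octonion := fun n z => w - z + (2 * d * n) • e 0
  have hv (n : ℤ) (z : Octonion) : HasFDerivAt (v n) conjL z :=
    (conjL.hasFDerivAt.add_const w).add_const _
  have hp (n : ℤ) (z : Octonion) : HasFDerivAt (p n) (-ContinuousLinearMap.id ℝ Octonion) z :=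
    ((hasFDerivAt_id z).const_sub w).add_const _
  have hI (n : ℤ) := integral_test_function_mul_eq_zero hU hf hφ hcs hsub
    (Φ := fun z => cauchyKernel (v n z)) (Φ' := fun z => (regKernelDeriv 0 (v n z)).comp conjL)
    (κ := fun z => (2 : ℝ) • cauchyKernelDeriv (v n z))
    (fun z hz => HasFDerivAt.comp (g := cauchyKernel) z
      (hasFDerivAt_cauchyKernel (conj_add_ne_zero hd hw hz n)) (hv n z))
    (fun z hz x => sum_regKernelDeriv_conj_mul (conj_add_ne_zero hd hw hz n) x)
    (ContinuousOn.fun_const_smul (ContinuousOn.comp (g := cauchyKernelDeriv)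
      continuousOn_cauchyKernelDeriv (fun z _ => (hv n z).continuousAt.continuousWithinAt)
      fun z hz => conj_add_ne_zero hd hw hz n) 2)
  -- Among the poles w + 2dn only n = 0 lies in the strip; the sign comes from q₀(w - z) = -q₀(z -
  -- w).
  have hII (n : ℤ) : Integrable (fun z => mul (cauchyKernel (p n z)) (mul (octGrad φ z) (f z))) ∧
      ∫ z, mul (cauchyKernel (p n z)) (mul (octGrad φ z) (f z)) =
        if n = 0 then (Real.pi ^ 4 / 3) • φ w • f w else 0 := by
    by_cases hn : n = 0
    · subst hn
      have h0 (z : Octonion) : cauchyKernel (p 0 z) = -cauchyKernel (z - w) := by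
        rw [← cauchyKernel_neg]
        simp [p]
      obtain ⟨h1, h2⟩ := cauchyPompeiu hU hf hφ hcs hsub hw hr hφw
      simp only [h0, Octonion.neg_mul, integral_neg, h2, neg_neg, if_true]
      exact ⟨h1.neg, trivial⟩
    · obtain ⟨-, h1, h2⟩ := integral_test_function_mul_eq_zero hU hf hφ hcs hsub
        (Φ := fun z => cauchyKernel (p n z))
        (Φ' := fun z => (regKernelDeriv 0 (p n z)).comp (-ContinuousLinearMap.id ℝ Octonion))
        (κ := fun z => 0)
        (fun z hz => HasFDerivAt.comp (g := cauchyKernel) z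
          (hasFDerivAt_cauchyKernel (sub_add_ne_zero hd hw hz hn)) (hp n z))
        (fun z hz x => by
          have h3 := sum_regKernelDeriv_mul 0 (p n z) x
            (by simpa using sub_add_ne_zero hd hw hz hn)
          simp only [mul_zero, zero_mul, zero_smul] at h3
          simp [Octonion.neg_mul, h3, Octonion.zero_mul])
        continuousOn_const
      refine ⟨h1, ?_⟩
      rw [if_neg hn, ← neg_eq_zero, ← h2]
      simp [← mulL_apply]
  let E : ℤ → Octonion → Octonion := fun n z =>
    φ z • mul ((2 : ℝ) • cauchyKernelDeriv (v n z)) (f z) +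
      (mul (cauchyKernel (v n z)) (mul (octGrad φ z) (f z)) -
        mul (cauchyKernel (p n z)) (mul (octGrad φ z) (f z)))
  have hEint (n : ℤ) : Integrable (E n) := (hI n).1.add ((hI n).2.1.sub (hII n).1)
  have hEval (n : ℤ) : ∫ z, E n z = if n = 0 then -((Real.pi ^ 4 / 3) • φ w • f w) else 0 := by
    have h1 : ∫ z, E n z = (∫ z, φ z • mul ((2 : ℝ) • cauchyKernelDeriv (v n z)) (f z)) +
        ((∫ z, mul (cauchyKernel (v n z)) (mul (octGrad φ z) (f z))) -
        ∫ z, mul (cauchyKernel (p n z)) (mul (octGrad φ z) (f z))) := by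
      rw [← integral_sub (hI n).2.1 (hII n).1]
      exact integral_add (hI n).1 ((hI n).2.1.sub (hII n).1)
    rw [h1, (hI n).2.2, (hII n).2]
    split_ifs <;> abel
  obtain ⟨c, hc, hcz⟩ := conj_add_mem_awayFromLattice hd hw
  obtain ⟨K₁, hK₁, h₁⟩ := norm_shift_le' hd hc (by norm_num) norm_cauchyKernelDeriv_le
  obtain ⟨K₂, hK₂, h₂⟩ := norm_shift_le' hd hc le_rfl norm_cauchyKernel_le
  obtain ⟨K₃, hK₃, h₃⟩ := norm_shift_le' hd (lt_min hr hd) le_rfl norm_cauchyKernel_le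
  let H : Octonion → ℝ := fun z => ‖φ z • f z‖ + ‖mul (octGrad φ z) (f z)‖
  have hH : Integrable H := by
    refine Integrable.add (Integrable.norm ?_) (Integrable.norm ?_)
    · refine integrable_of_eq_zero_of_notMem_tsupport hcs hsub
        (fun z hz => by simp [image_eq_zero_of_notMem_tsupport hz]) fun z hz => ?_
      have h1 := (hf.1.differentiableAt (hU.mem_nhds hz)).continuousAt
      have h2 := hφ.continuous.continuousAt (x := z)
      fun_prop
    · refine integrable_of_eq_zero_of_notMem_tsupport hcs hsub (fun z hz => ?_) fun z hz => ?_
      · simp [octGrad_eq_zero_of_notMem_tsupport hz, ← mulL_apply]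
      have h1 := (hf.1.differentiableAt (hU.mem_nhds hz)).continuousAt
      have h2 := (continuous_octGrad hφ).continuousAt (x := z)
      simp only [← mulL_apply]
      fun_prop
  -- The singularity of q₀(w - z) is always multiplied by the gradient, so its bounds are needed
  -- only at distance at least `r` from `w`.
  have hgrad (z : Octonion) (hz : octGrad φ z ≠ 0) : r ≤ ‖z - w‖ := by
    by_contra! h
    exact hz (hφw z h)
  have hEb (n : ℤ) (z : Octonion) :
      ‖E n z‖ ≤ ((2 * K₁ + K₂ + K₃) * latticeWeight n) * H z := by
    have hwt := latticeWeight_nonneg n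
    by_cases hz : z ∈ tsupport φ
    · have hzS := hsub hz
      have e1 : ‖φ z • mul ((2 : ℝ) • cauchyKernelDeriv (v n z)) (f z)‖ ≤
          2 * K₁ * latticeWeight n * ‖φ z • f z‖ := by
        rw [norm_smul, Octonion.norm_mul, norm_smul, norm_smul, Real.norm_ofNat]
        calc ‖φ z‖ * (2 * ‖cauchyKernelDeriv (v n z)‖ * ‖f z‖)
            ≤ ‖φ z‖ * (2 * (K₁ * latticeWeight n) * ‖f z‖) := by
              gcongr
              exact h₁ _ (hcz z hzS) n
          _ = _ := by ring
      have e2 : ‖mul (cauchyKernel (v n z)) (mul (octGrad φ z) (f z)) -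
          mul (cauchyKernel (p n z)) (mul (octGrad φ z) (f z))‖ ≤
          (K₂ + K₃) * latticeWeight n * ‖mul (octGrad φ z) (f z)‖ := by
        rw [← Octonion.sub_mul, Octonion.norm_mul]
        by_cases hg : octGrad φ z = 0
        · simp [hg, ← mulL_apply]
        · gcongr
          rw [_root_.add_mul]
          exact (norm_sub_le _ _).trans (add_le_add (h₂ _ (hcz z hzS) n)
            (h₃ _ (sub_mem_awayFromLattice hd hw hzS (hgrad z hg)) n))
      refine (norm_add_le _ _).trans ((add_le_add e1 e2).trans ?_)
      have g1 : 0 ≤ (K₂ + K₃) * latticeWeight n * ‖φ z • f z‖ := by positivity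
      have g2 : 0 ≤ 2 * K₁ * latticeWeight n * ‖mul (octGrad φ z) (f z)‖ := by positivity
      simp only [H]
      linarith
    · have h0 : E n z = 0 := by
        simp [E, image_eq_zero_of_notMem_tsupport hz, octGrad_eq_zero_of_notMem_tsupport hz,
          ← mulL_apply]
      rw [h0, norm_zero]
      positivity
  obtain ⟨g1, g2⟩ := integrable_tsum_of_norm_le hEint
    (summable_latticeWeight.mul_left (2 * K₁ + K₂ + K₃)) hH hEb
  have hsumE (z : Octonion) : ∑' n, E n z =
      φ z • stripIntegrand d w f z + mul (stripDiff d w z) (mul (octGrad φ z) (f z)) := by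
    by_cases hz : z ∈ tsupport φ
    · have hzS := hsub hz
      have s1 : HasSum (fun n => φ z • mul ((2 : ℝ) • cauchyKernelDeriv (v n z)) (f z))
          (φ z • stripIntegrand d w f z) :=
        ((mulL.flip (f z)).hasSum ((summable_shift hd hc (by norm_num) norm_cauchyKernelDeriv_le
          (hcz z hzS)).hasSum.const_smul (2 : ℝ))).const_smul (φ z)
      by_cases hg : octGrad φ z = 0
      · simpa [E, hg, ← mulL_apply] using s1.tsum_eq
      · have s2 := (summable_shift hd hc le_rfl norm_cauchyKernel_le (hcz z hzS)).hasSum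
        have s3 := (summable_shift hd (lt_min hr hd) le_rfl norm_cauchyKernel_le
          (sub_mem_awayFromLattice hd hw hzS (hgrad z hg))).hasSum
        have s4 := (mulL.flip (mul (octGrad φ z) (f z))).hasSum (s2.sub s3)
        have s5 := s1.add s4
        refine (tsum_congr fun n => ?_).trans s5.tsum_eq
        simp only [E, ← Octonion.sub_mul]
        rfl
    · simp [E, image_eq_zero_of_notMem_tsupport hz, octGrad_eq_zero_of_notMem_tsupport hz,
        ← mulL_apply]
  simp only [hsumE] at g1 g2
  refine ⟨g1, ?_⟩
  simp only [hEval] at g2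
  exact g2.unique (hasSum_ite_eq 0 _)

/-! ### Cutoff functions exhausting the strip -/

theorem exists_abs_deriv_smoothTransition_le :
    ∃ M : ℝ, 0 < M ∧ ∀ x, |deriv Real.smoothTransition x| ≤ M := by
  have hc : Continuous (deriv Real.smoothTransition) :=
    (Real.smoothTransition.contDiff (n := 1)).continuous_deriv_one
  obtain ⟨M, hM⟩ := (isCompact_Icc (a := (0 : ℝ)) (b := 1)).exists_bound_of_continuousOn
    hc.continuousOn
  refine ⟨max M 1, by positivity, fun x => ?_⟩
  by_cases hx : x ∈ Set.Icc (0 : ℝ) 1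
  · exact (hM x hx).trans (le_max_left _ _)
  · have h0 : deriv Real.smoothTransition x = 0 := by
      rw [Set.mem_Icc, not_and_or, not_le, not_le] at hx
      rcases hx with hx | hx
      · have : Real.smoothTransition =ᶠ[𝓝 x] fun _ => 0 := by
          filter_upwards [Iio_mem_nhds hx] with y hy
          exact Real.smoothTransition.zero_of_nonpos (le_of_lt hy)
        rw [this.deriv_eq, deriv_const]
      · have : Real.smoothTransition =ᶠ[𝓝 x] fun _ => 1 := by
          filter_upwards [Ioi_mem_nhds hx] with y hy
          exact Real.smoothTransition.one_of_one_le (le_of_lt hy)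
        rw [this.deriv_eq, deriv_const]
    rw [h0, abs_zero]
    positivity

/-- A defining function of the strip which decays at infinity. -/
def stripDefining (d : ℝ) (z : Octonion) : ℝ := re z * (d - re z) * (1 + ‖z‖ ^ 2)⁻¹

theorem contDiff_re : ContDiff ℝ 1 re := by unfold re; fun_prop

theorem contDiff_stripDefining (d : ℝ) : ContDiff ℝ 1 (stripDefining d) := by
  have h0 (z : Octonion) : 1 + ‖z‖ ^ 2 ≠ 0 := by positivity
  have h1 := contDiff_re
  have h2 : ContDiff ℝ 1 fun z : Octonion => (1 + ‖z‖ ^ 2)⁻¹ :=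
    (contDiff_const.add (contDiff_norm_sq ℝ)).inv h0
  exact (h1.mul (contDiff_const.sub h1)).mul h2

theorem stripDefining_pos {d : ℝ} {z : Octonion} (hz : z ∈ strip d) : 0 < stripDefining d z := by
  have h1 : 0 < re z := hz.1
  have h2 : 0 < d - re z := by linarith [hz.2]
  unfold stripDefining
  positivity

theorem mem_strip_of_stripDefining_pos {d : ℝ} (hd : 0 < d) {z : Octonion}
    (hz : 0 < stripDefining d z) : z ∈ strip d := by
  have h0 : 0 < (1 + ‖z‖ ^ 2)⁻¹ := by positivity
  have h1 : 0 < re z * (d - re z) := by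
    by_contra! h
    exact hz.not_ge (mul_nonpos_of_nonpos_of_nonneg h h0.le)
  constructor
  · by_contra! h; nlinarith
  · by_contra! h; nlinarith

/-- The gradient is at most (d + d²)/(1 + |z|²), the two summands coming from the factor x₀(d - x₀)
and from the decaying factor. -/
theorem norm_fderiv_stripDefining_le {d : ℝ} (hd : 0 < d) {z : Octonion} (hz : z ∈ strip d) :
    re z * (d - re z) * ‖fderiv ℝ (stripDefining d) z‖ ≤ (d + d ^ 2) * stripDefining d z := by
  have hz0 : 0 < re z := hz.1
  have hzd : 0 < d - re z := by linarith [hz.2]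
  have hre : HasFDerivAt re (innerSL ℝ (e 0)) z := by
    convert! (innerSL ℝ (e 0)).hasFDerivAt using 1
    ext h
    simp [inner_e_zero_left]
  have h1 : HasFDerivAt (fun y : Octonion => (1 + ‖y‖ ^ 2)⁻¹)
      ((-(2 * ((1 + ‖z‖ ^ 2) ^ 2)⁻¹)) • innerSL ℝ z) z := by
    have := hasFDerivAt_inv_norm_sq_add_pow 1 1 z (by positivity)
    simp only [pow_one, add_comm _ (1 : ℝ)] at this
    convert! this using 2
    norm_num
  have h2 : HasFDerivAt (stripDefining d)
      ((re z * (d - re z)) • ((-(2 * ((1 + ‖z‖ ^ 2) ^ 2)⁻¹)) • innerSL ℝ z) +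
        (1 + ‖z‖ ^ 2)⁻¹ • (re z • -(innerSL ℝ (e 0)) + (d - re z) • innerSL ℝ (e 0))) z :=
    (hre.mul (hre.const_sub d)).mul h1
  have hb : (1 + ‖z‖ ^ 2)⁻¹ * (2 * ‖z‖) ≤ 1 := by
    rw [inv_mul_le_iff₀ (by positivity)]
    nlinarith [sq_nonneg (‖z‖ - 1)]
  set b := (1 + ‖z‖ ^ 2)⁻¹ with hbdef
  have hb0 : 0 < b := by positivity
  have hnorm : ‖fderiv ℝ (stripDefining d) z‖ ≤ (d + d ^ 2) * b := by
    refine ContinuousLinearMap.opNorm_le_bound _ (by positivity) fun h => ?_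
    rw [h2.fderiv]
    have e1 : |re h| ≤ ‖h‖ := abs_re_le_norm h
    have e2 : |inner ℝ z h| ≤ ‖z‖ * ‖h‖ := abs_real_inner_le_norm z h
    have e3 : |d - 2 * re z| ≤ d := abs_le.2 ⟨by linarith, by linarith⟩
    have e4 : re z * (d - re z) ≤ d ^ 2 := by nlinarith
    have e5 : ((re z * (d - re z)) • ((-(2 * ((1 + ‖z‖ ^ 2) ^ 2)⁻¹)) • innerSL ℝ z) +
        b • (re z • -(innerSL ℝ (e 0)) + (d - re z) • innerSL ℝ (e 0))) h =
        (d - 2 * re z) * re h * b - re z * (d - re z) * (b * (2 * inner ℝ z h)) * b := by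
      simp only [hbdef, ← inv_pow]
      simp [inner_e_zero_left, -inv_pow]
      ring
    refine (congrArg norm e5).trans_le ?_
    calc _ ≤ ‖(d - 2 * re z) * re h * b‖ + ‖re z * (d - re z) * (b * (2 * inner ℝ z h)) * b‖ :=
          norm_sub_le _ _
      _ = |d - 2 * re z| * |re h| * b +
          re z * (d - re z) * (b * (2 * |inner ℝ z h|)) * b := by
          simp only [Real.norm_eq_abs, abs_mul, abs_of_pos hb0, abs_of_pos hz0, abs_of_pos hzd,
            abs_two]
      _ ≤ d * ‖h‖ * b + d ^ 2 * (b * (2 * (‖z‖ * ‖h‖))) * b := by gcongr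
      _ = d * ‖h‖ * b + d ^ 2 * (b * (2 * ‖z‖)) * ‖h‖ * b := by ring
      _ ≤ d * ‖h‖ * b + d ^ 2 * 1 * ‖h‖ * b := by gcongr
      _ = _ := by ring
  calc re z * (d - re z) * ‖fderiv ℝ (stripDefining d) z‖
      ≤ re z * (d - re z) * ((d + d ^ 2) * b) := by gcongr
    _ = (d + d ^ 2) * stripDefining d z := by rw [stripDefining]; ring

/-- The exhausting cutoff functions of the strip. -/
def stripCutoff (d k : ℝ) (z : Octonion) : ℝ := Real.smoothTransition (k * stripDefining d z - 1)

theorem contDiff_stripCutoff (d k : ℝ) : ContDiff ℝ 1 (stripCutoff d k) :=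
  (Real.smoothTransition.contDiff (n := 1)).comp
    ((contDiff_const.mul (contDiff_stripDefining d)).sub contDiff_const)

theorem stripCutoff_nonneg (d k : ℝ) (z : Octonion) : 0 ≤ stripCutoff d k z :=
  Real.smoothTransition.nonneg _

theorem stripCutoff_le_one (d k : ℝ) (z : Octonion) : stripCutoff d k z ≤ 1 :=
  Real.smoothTransition.le_one _

theorem stripCutoff_eq_one {d k : ℝ} {z : Octonion} (h : 2 ≤ k * stripDefining d z) :
    stripCutoff d k z = 1 := Real.smoothTransition.one_of_one_le (by linarith)

theorem tsupport_stripCutoff_subset {d k : ℝ} :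
    tsupport (stripCutoff d k) ⊆ {z | 1 ≤ k * stripDefining d z} := by
  refine closure_minimal (fun z hz => ?_)
    (isClosed_le continuous_const (continuous_const.mul (contDiff_stripDefining d).continuous))
  by_contra h
  simp only [Set.mem_ofPred_eq, not_le] at h
  exact hz (Real.smoothTransition.zero_of_nonpos (by linarith))

theorem tsupport_stripCutoff_subset_strip {d k : ℝ} (hd : 0 < d) (hk : 0 < k) :
    tsupport (stripCutoff d k) ⊆ strip d := fun z hz => by
  have h : 1 ≤ k * stripDefining d z := tsupport_stripCutoff_subset hz
  exact mem_strip_of_stripDefining_pos hd (by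
    by_contra! h0
    nlinarith)

theorem hasCompactSupport_stripCutoff {d k : ℝ} (hd : 0 < d) (hk : 0 < k) :
    HasCompactSupport (stripCutoff d k) := by
  refine (ProperSpace.isCompact_closedBall (0 : Octonion) (k * d ^ 2 + 1)).of_isClosed_subset
    (isClosed_tsupport _) fun z hz => ?_
  have h1 := tsupport_stripCutoff_subset_strip hd hk hz
  have h2 : 1 ≤ k * stripDefining d z := tsupport_stripCutoff_subset hz
  have h3 : re z * (d - re z) ≤ d ^ 2 := by nlinarith [h1.1, h1.2]
  rw [stripDefining, ← div_eq_mul_inv, ← mul_div_assoc, one_le_div (by positivity)] at h2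
  rw [mem_closedBall_zero_iff]
  have h4 : 1 + ‖z‖ ^ 2 ≤ k * d ^ 2 := h2.trans (by gcongr)
  nlinarith [sq_nonneg (‖z‖ - 1)]

theorem octGrad_stripCutoff_eq_zero {d k : ℝ} {z : Octonion} (h : 2 < k * stripDefining d z) :
    octGrad (stripCutoff d k) z = 0 := by
  have hc : Continuous fun z => k * stripDefining d z :=
    continuous_const.mul (contDiff_stripDefining d).continuous
  have : stripCutoff d k =ᶠ[𝓝 z] fun _ => 1 := by
    filter_upwards [(isOpen_lt continuous_const hc).mem_nhds h] with y hy
    exact stripCutoff_eq_one (le_of_lt hy)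
  simp [octGrad, this.fderiv_eq]

theorem norm_octGrad_le (φ : Octonion → ℝ) (z : Octonion) :
    ‖octGrad φ z‖ ≤ 8 * ‖fderiv ℝ φ z‖ := by
  refine (norm_sum_le _ _).trans ?_
  calc ∑ i, ‖fderiv ℝ φ z (e i) • e i‖ ≤ ∑ _i : Fin 8, ‖fderiv ℝ φ z‖ := by
        refine Finset.sum_le_sum fun i _ => ?_
        rw [norm_smul, norm_e, mul_one]
        simpa [norm_e] using (fderiv ℝ φ z).le_opNorm (e i)
    _ = 8 * ‖fderiv ℝ φ z‖ := by simp

/-- The point is uniformity in k: differentiating the cutoff produces a factor k, but its gradient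
can be nonzero only where k · `stripDefining` ≤ 2, and `norm_fderiv_stripDefining_le` supplies the
factor `stripDefining`. -/
theorem norm_octGrad_stripCutoff_le {d : ℝ} (hd : 0 < d) : ∃ C : ℝ, 0 < C ∧ ∀ k > 0,
    ∀ z ∈ strip d, re z * (d - re z) * ‖octGrad (stripCutoff d k) z‖ ≤ C := by
  obtain ⟨M, hM, h⟩ := exists_abs_deriv_smoothTransition_le
  refine ⟨16 * M * (d + d ^ 2), by positivity, fun k hk z hz => ?_⟩
  have hz0 : 0 < re z := hz.1
  have hzd : 0 < d - re z := by linarith [hz.2]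
  rcases lt_or_ge 2 (k * stripDefining d z) with h2 | h2
  · rw [octGrad_stripCutoff_eq_zero h2, norm_zero, mul_zero]
    positivity
  · have h3 : fderiv ℝ (stripCutoff d k) z = (deriv Real.smoothTransition
        (k * stripDefining d z - 1)) • k • fderiv ℝ (stripDefining d) z := by
      have e1 := ((contDiff_stripDefining d).differentiable one_ne_zero z).hasFDerivAt
      have e2 : HasFDerivAt (fun z => k * stripDefining d z - 1)
        (k • fderiv ℝ (stripDefining d) z) z := (e1.const_mul k).sub_const 1
      have e3 := ((Real.smoothTransition.contDiff (n := 1)).differentiable one_ne_zero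
        (k * stripDefining d z - 1)).hasDerivAt
      exact (e3.comp_hasFDerivAt z e2).fderiv
    calc re z * (d - re z) * ‖octGrad (stripCutoff d k) z‖
        ≤ re z * (d - re z) * (8 * ‖fderiv ℝ (stripCutoff d k) z‖) := by
          gcongr; exact norm_octGrad_le _ _
      _ = 8 * |deriv Real.smoothTransition (k * stripDefining d z - 1)| * k *
          (re z * (d - re z) * ‖fderiv ℝ (stripDefining d) z‖) := by
          rw [h3, norm_smul, norm_smul, Real.norm_eq_abs, Real.norm_of_nonneg hk.le]
          ring
      _ ≤ 8 * M * k * ((d + d ^ 2) * stripDefining d z) :=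
          mul_le_mul (by gcongr; exact h _) (norm_fderiv_stripDefining_le hd hz)
            (by positivity) (by positivity)
      _ = 8 * M * (d + d ^ 2) * (k * stripDefining d z) := by ring
      _ ≤ 8 * M * (d + d ^ 2) * 2 := by gcongr
      _ = _ := by ring

/-! ### Passage to the limit and the reproducing formula -/

/-- The square decays with exponent 10, which exceeds the dimension 8. -/
theorem memLp_weight (U : Set Octonion) :
    MemLp (fun z : Octonion => ((1 + ‖z‖) ^ 5)⁻¹) 2 (volume.restrict U) := by
  have h0 (z : Octonion) : (1 + ‖z‖) ^ 5 ≠ 0 := by positivity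
  have hc : Continuous fun z : Octonion => ((1 + ‖z‖) ^ 5)⁻¹ := by
    fun_prop (disch := assumption)
  rw [memLp_two_iff_integrable_sq hc.aestronglyMeasurable]
  refine Integrable.restrict ?_
  have h1 := integrable_one_add_norm (E := Octonion) (μ := volume) (r := 10) (by
    rw [finrank_euclideanSpace, Fintype.card_fin]; norm_num)
  refine h1.congr (Eventually.of_forall fun z => ?_)
  simp only
  rw [Real.rpow_neg (by positivity), show (10 : ℝ) = ((10 : ℕ) : ℝ) by norm_num,
    Real.rpow_natCast, inv_pow, ← pow_mul]

theorem integrable_weight_mul_norm {U : Set Octonion} {f : Octonion → Octonion}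
    (hf : MemLp f 2 (volume.restrict U)) :
    Integrable (fun z => ((1 + ‖z‖) ^ 5)⁻¹ * ‖f z‖) (volume.restrict U) :=
  (memLp_weight U).integrable_mul hf.norm

/-- The reproducing formula of the strip. -/
theorem integral_stripIntegrand {d : ℝ} (hd : 0 < d) {w : Octonion} (hw : w ∈ strip d)
    {f : Octonion → Octonion} (hf : MemBergmanSpace (strip d) f) :
    ∫ z in strip d, stripIntegrand d w f z = -((Real.pi ^ 4 / 3) • f w) := by
  have hU := isOpen_strip d
  have hw0 := stripDefining_pos hw
  obtain ⟨r, hr, hball⟩ : ∃ r > 0, ∀ z, ‖z - w‖ < r →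
      stripDefining d w / 2 < stripDefining d z := by
    have h1 := (isOpen_lt continuous_const (contDiff_stripDefining d).continuous).mem_nhds
      (show stripDefining d w / 2 < stripDefining d w by linarith)
    obtain ⟨r, hr, h⟩ := Metric.mem_nhds_iff.1 h1
    exact ⟨r, hr, fun z hz => h (by rwa [Metric.mem_ball, dist_eq_norm])⟩
  -- Makes k · `stripDefining` exceed 2 on the whole ball of radius `r` for k ≥ k₀, so these cutoffs
  -- equal 1 there.
  set k₀ : ℝ := 4 / stripDefining d w with hk₀
  have hk₀0 : 0 < k₀ := by positivity
  have hgrad (k : ℝ) (hk : k₀ ≤ k) (z : Octonion) (hz : ‖z - w‖ < r) :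
      octGrad (stripCutoff d k) z = 0 := by
    refine octGrad_stripCutoff_eq_zero ?_
    have h1 := hball z hz
    calc (2 : ℝ) = k₀ * (stripDefining d w / 2) := by rw [hk₀]; field_simp; norm_num
      _ < k₀ * stripDefining d z := by gcongr
      _ ≤ k * stripDefining d z := by gcongr; linarith
  let E : ℝ → Octonion → Octonion := fun k z => stripCutoff d k z • stripIntegrand d w f z +
    mul (stripDiff d w z) (mul (octGrad (stripCutoff d k) z) (f z))
  have hid (k : ℝ) (hk : k₀ ≤ k) : Integrable (E k) ∧
      ∫ z, E k z = -((Real.pi ^ 4 / 3) • stripCutoff d k w • f w) := by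
    have hk0 := hk₀0.trans_le hk
    exact integral_test_function_strip hd hw hf.2 (contDiff_stripCutoff d k)
      (hasCompactSupport_stripCutoff hd hk0) (tsupport_stripCutoff_subset_strip hd hk0) hr
      (hgrad k hk)
  have hval (k : ℝ) (hk : k₀ ≤ k) : ∫ z in strip d, E k z = -((Real.pi ^ 4 / 3) • f w) := by
    rw [setIntegral_eq_integral_of_forall_compl_eq_zero, (hid k hk).2, stripCutoff_eq_one, one_smul]
    · have h1 : k₀ * stripDefining d w = 4 := by rw [hk₀]; field_simp
      nlinarith
    · intro z hz
      have hz' : z ∉ tsupport (stripCutoff d k) := fun h =>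
        hz (tsupport_stripCutoff_subset_strip hd (hk₀0.trans_le hk) h)
      simp [E, image_eq_zero_of_notMem_tsupport hz', octGrad_eq_zero_of_notMem_tsupport hz',
        ← mulL_apply]
  obtain ⟨C₁, hC₁, h₁⟩ := norm_stripDiff_le hd hr hw
  obtain ⟨C₂, hC₂, h₂⟩ := norm_octGrad_stripCutoff_le hd
  obtain ⟨c, hc, hcz⟩ := conj_add_mem_awayFromLattice hd hw
  obtain ⟨C₃, hC₃, h₃⟩ := norm_tsum_shift_le hd hc (by norm_num) norm_cauchyKernelDeriv_le
  set C₄ := 2 * (C₃ * (1 + ‖w‖) ^ 5) with hC₄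
  have hker (z : Octonion) (hz : z ∈ strip d) :
      ‖stripIntegrand d w f z‖ ≤ C₄ * (((1 + ‖z‖) ^ 5)⁻¹ * ‖f z‖) := by
    have h4 := norm_sub_le (conj z + w) w
    rw [add_sub_cancel_right, norm_conj] at h4
    rw [stripIntegrand, Octonion.norm_mul, norm_smul, Real.norm_ofNat]
    calc 2 * ‖periodicKernelDeriv d (conj z + w)‖ * ‖f z‖
        ≤ 2 * (C₃ * ((1 + ‖conj z + w‖) ^ 5)⁻¹) * ‖f z‖ := by
          gcongr; exact h₃ _ (hcz z hz)
      _ ≤ 2 * (C₃ * ((1 + ‖w‖) ^ 5 * ((1 + ‖z‖) ^ 5)⁻¹)) * ‖f z‖ := by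
          gcongr; exact weight_le (norm_nonneg w) h4
      _ = _ := by ring
  -- The factor x₀(d - x₀) from `stripDiff` absorbs the cutoff gradient, leaving a bound independent
  -- of k and integrable by Cauchy–Schwarz.
  have hdom (k : ℝ) (hk : k₀ ≤ k) (z : Octonion) (hz : z ∈ strip d) :
      ‖E k z‖ ≤ (C₄ + C₁ * C₂) * (((1 + ‖z‖) ^ 5)⁻¹ * ‖f z‖) := by
    have e1 : ‖stripCutoff d k z • stripIntegrand d w f z‖ ≤
        C₄ * (((1 + ‖z‖) ^ 5)⁻¹ * ‖f z‖) := by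
      rw [norm_smul, Real.norm_of_nonneg (stripCutoff_nonneg d k z)]
      exact (mul_le_of_le_one_left (norm_nonneg _) (stripCutoff_le_one d k z)).trans (hker z hz)
    have e2 : ‖mul (stripDiff d w z) (mul (octGrad (stripCutoff d k) z) (f z))‖ ≤
        C₁ * C₂ * (((1 + ‖z‖) ^ 5)⁻¹ * ‖f z‖) := by
      rw [Octonion.norm_mul, Octonion.norm_mul]
      rcases lt_or_ge ‖z - w‖ r with hzr | hzr
      · rw [hgrad k hk z hzr, norm_zero]
        simp only [zero_mul, mul_zero]
        positivity
      · calc ‖stripDiff d w z‖ * (‖octGrad (stripCutoff d k) z‖ * ‖f z‖)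
            ≤ (C₁ * (re z * (d - re z)) * ((1 + ‖z‖) ^ 5)⁻¹) *
              (‖octGrad (stripCutoff d k) z‖ * ‖f z‖) := by
              gcongr; exact h₁ z hz hzr
          _ = C₁ * (re z * (d - re z) * ‖octGrad (stripCutoff d k) z‖) *
              (((1 + ‖z‖) ^ 5)⁻¹ * ‖f z‖) := by ring
          _ ≤ _ := by
              gcongr
              exact h₂ k (hk₀0.trans_le hk) z hz
    rw [_root_.add_mul]
    exact (norm_add_le _ _).trans (add_le_add e1 e2)
  -- At a fixed point of the strip the cutoff is locally 1 for large k, so the sequence is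
  -- eventually constant.
  have hptw (z : Octonion) (hz : z ∈ strip d) :
      Tendsto (fun k => E k z) atTop (𝓝 (stripIntegrand d w f z)) := by
    refine tendsto_const_nhds.congr' ?_
    have hz0 := stripDefining_pos hz
    filter_upwards [eventually_gt_atTop (2 / stripDefining d z)] with k hk
    rw [div_lt_iff₀ hz0] at hk
    simp [E, stripCutoff_eq_one hk.le, octGrad_stripCutoff_eq_zero hk, ← mulL_apply]
  have hlim : Tendsto (fun k => ∫ z in strip d, E k z) atTop
      (𝓝 (∫ z in strip d, stripIntegrand d w f z)) := by
    refine tendsto_integral_filter_of_dominated_convergence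
      (fun z => (C₄ + C₁ * C₂) * (((1 + ‖z‖) ^ 5)⁻¹ * ‖f z‖)) ?_ ?_
      ((integrable_weight_mul_norm hf.1).const_mul _)
      ((ae_restrict_mem hU.measurableSet).mono hptw)
    · filter_upwards [eventually_ge_atTop k₀] with k hk
      exact (hid k hk).1.aestronglyMeasurable.restrict
    · filter_upwards [eventually_ge_atTop k₀] with k hk
      exact (ae_restrict_mem hU.measurableSet).mono (hdom k hk)
  refine tendsto_nhds_unique hlim (tendsto_const_nhds.congr' ?_)
  filter_upwards [eventually_ge_atTop k₀] with k hk using (hval k hk).symm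

/-! ### The Bergman kernel: membership and uniqueness -/

/-- The Bergman kernel of the strip. -/
def stripKernel (d : ℝ) (z w : Octonion) : Octonion :=
  (-2 : ℝ) • periodicKernelDeriv d (z + conj w)

theorem conj_lattice_point (d : ℝ) (z w : Octonion) (n : ℤ) :
    conj (conj z + w + (2 * d * n) • e 0) = z + conj w + (2 * d * n) • e 0 := by
  rw [conj_add, conj_add, conj_conj, conj_smul, conj_e_zero]

theorem conj_stripKernel {d : ℝ} (hd : 0 < d) {z w : Octonion} (hz : z ∈ strip d)
    (hw : w ∈ strip d) :
    conj (stripKernel d z w) = (-2 : ℝ) • periodicKernelDeriv d (conj z + w) := by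
  obtain ⟨c, hc, hcz⟩ := conj_add_mem_awayFromLattice hd hw
  have hs := summable_shift hd hc (by norm_num) norm_cauchyKernelDeriv_le (hcz z hz)
  rw [stripKernel, conj_smul]
  congr 1
  rw [← conj_conj (periodicKernelDeriv d (conj z + w))]
  congr 1
  have h1 := conjL.map_tsum hs
  rw [conjL_apply] at h1
  rw [periodicKernelDeriv, periodicKernelDeriv, h1]
  refine tsum_congr fun n => ?_
  rw [conjL_apply, conj_cauchyKernelDeriv, conj_lattice_point]

theorem bergmanInner_stripKernel {d : ℝ} (hd : 0 < d) {w : Octonion} (hw : w ∈ strip d)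
    {f : Octonion → Octonion} (hf : MemBergmanSpace (strip d) f) :
    f w = bergmanInner (strip d) f (fun z => stripKernel d z w) := by
  have h1 : ∫ z in strip d, mul (conj (stripKernel d z w)) (f z) =
      ∫ z in strip d, -stripIntegrand d w f z := by
    refine setIntegral_congr_fun (isOpen_strip d).measurableSet fun z hz => ?_
    simp only [conj_stripKernel hd hz hw, stripIntegrand, neg_smul, Octonion.neg_mul]
  have hpi := Real.pi_pos
  rw [bergmanInner, h1, integral_neg, integral_stripIntegrand hd hw hf, neg_neg, smul_smul]
  rw [show 3 / Real.pi ^ 4 * (Real.pi ^ 4 / 3) = 1 by field_simp, one_smul]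

theorem isLeftRegularOn_of_hasFDerivAt {U : Set Octonion} {f : Octonion → Octonion}
    (h : ∀ z ∈ U, ∃ L : Octonion →L[ℝ] Octonion, HasFDerivAt f L z ∧ leftSymbol L = 0) :
    IsLeftRegularOn f U := by
  refine ⟨fun z hz => ?_, fun z hz => ?_⟩ <;> obtain ⟨L, hL, hL'⟩ := h z hz
  · exact hL.differentiableAt.differentiableWithinAt
  · rw [cauchyRiemann_eq_leftSymbol hL, hL']

theorem re_add_conj_mem {d : ℝ} {z w : Octonion} (hz : z ∈ strip d) (hw : w ∈ strip d) :
    0 < re (z + conj w) ∧ re (z + conj w) < 2 * d := by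
  rw [re_add, re_conj]
  constructor <;> linarith [hz.1, hz.2, hw.1, hw.2]

theorem isLeftRegularOn_stripKernel {d : ℝ} (hd : 0 < d) {w : Octonion} (hw : w ∈ strip d) :
    IsLeftRegularOn (fun z => stripKernel d z w) (strip d) := by
  refine isLeftRegularOn_of_hasFDerivAt fun z hz => ?_
  obtain ⟨h1, h2⟩ := re_add_conj_mem hz hw
  obtain ⟨L, hL, hL'⟩ := hasFDerivAt_periodicKernelDeriv hd h1 h2
  refine ⟨(-2 : ℝ) • L, ?_, ?_⟩
  · exact (HasFDerivAt.comp (g := periodicKernelDeriv d) z hL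
      ((hasFDerivAt_id z).add_const (conj w))).const_smul (-2 : ℝ)
  · rw [leftSymbol] at hL' ⊢
    simp only [smul_apply, Octonion.mul_smul, ← Finset.smul_sum, hL', smul_zero]

theorem memBergmanSpace_stripKernel {d : ℝ} (hd : 0 < d) {w : Octonion} (hw : w ∈ strip d) :
    MemBergmanSpace (strip d) (fun z => stripKernel d z w) := by
  have hreg := isLeftRegularOn_stripKernel hd hw
  refine ⟨?_, hreg⟩
  obtain ⟨c, hc, hcz⟩ := conj_add_mem_awayFromLattice hd hw
  obtain ⟨K, hK, h⟩ := norm_tsum_shift_le hd hc (by norm_num) norm_cauchyKernelDeriv_le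
  have hmeas := (isOpen_strip d).measurableSet
  refine (memLp_weight (strip d)).of_le_mul (c := 2 * (K * (1 + ‖w‖) ^ 5))
    (hreg.1.continuousOn.aestronglyMeasurable hmeas)
    ((ae_restrict_mem hmeas).mono fun z hz => ?_)
  have h1 := norm_sub_le (conj z + w) w
  rw [add_sub_cancel_right, norm_conj] at h1
  rw [← norm_conj, conj_stripKernel hd hz hw, norm_smul, Real.norm_of_nonneg
    (by positivity : (0 : ℝ) ≤ ((1 + ‖z‖) ^ 5)⁻¹), norm_neg, Real.norm_ofNat]
  calc 2 * ‖periodicKernelDeriv d (conj z + w)‖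
      ≤ 2 * (K * ((1 + ‖conj z + w‖) ^ 5)⁻¹) := by gcongr; exact h _ (hcz z hz)
    _ ≤ 2 * (K * ((1 + ‖w‖) ^ 5 * ((1 + ‖z‖) ^ 5)⁻¹)) := by
        gcongr; exact weight_le (norm_nonneg w) h1
    _ = _ := by ring

theorem isBergmanKernel_stripKernel {d : ℝ} (hd : 0 < d) :
    IsBergmanKernel (strip d) (stripKernel d) := fun _ hw =>
  ⟨memBergmanSpace_stripKernel hd hw, fun _ hf => bergmanInner_stripKernel hd hw hf⟩

theorem MemBergmanSpace.sub {U : Set Octonion} (hU : IsOpen U) {f g : Octonion → Octonion}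
    (hf : MemBergmanSpace U f) (hg : MemBergmanSpace U g) :
    MemBergmanSpace U (fun z => f z - g z) := by
  refine ⟨hf.1.sub hg.1, isLeftRegularOn_of_hasFDerivAt fun z hz => ?_⟩
  refine ⟨_, (hf.2.1.differentiableAt (hU.mem_nhds hz)).hasFDerivAt.sub
    (hg.2.1.differentiableAt (hU.mem_nhds hz)).hasFDerivAt, ?_⟩
  have h1 := leftSymbol_fderiv_eq_zero hU hf.2 hz
  have h2 := leftSymbol_fderiv_eq_zero hU hg.2 hz
  rw [leftSymbol] at h1 h2 ⊢
  simp only [sub_apply, Octonion.mul_sub, Finset.sum_sub_distrib, h1, h2,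
    sub_zero]

theorem MemBergmanSpace.integrable_conj_mul {U : Set Octonion} (hU : IsOpen U)
    {f g : Octonion → Octonion} (hf : MemBergmanSpace U f) (hg : MemBergmanSpace U g) :
    Integrable (fun z => mul (conj (g z)) (f z)) (volume.restrict U) := by
  have hfc := hf.2.1.continuousOn
  have hgc := hg.2.1.continuousOn
  have hc : ContinuousOn (fun z => mul (conj (g z)) (f z)) U := by
    simp only [← mulL_apply, ← conjL_apply]
    fun_prop
  refine (hg.1.norm.integrable_mul hf.1.norm).mono'
    (hc.aestronglyMeasurable hU.measurableSet) (Eventually.of_forall fun z => ?_)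
  rw [Octonion.norm_mul, norm_conj]
  rfl

/-- The difference g of the two kernels at w lies in the space. Both kernels reproduce g(w), so
subtracting gives ∫ conj(g) g = 0. This is e₀ times ∫ |g|², hence g = 0 almost everywhere, and
everywhere on U by continuity. -/
theorem IsBergmanKernel.eq {U : Set Octonion} (hU : IsOpen U)
    {K B : Octonion → Octonion → Octonion} (hK : IsBergmanKernel U K) (hB : IsBergmanKernel U B)
    {z w : Octonion} (hz : z ∈ U) (hw : w ∈ U) : K z w = B z w := by
  obtain ⟨hKw, hK'⟩ := hK w hw
  obtain ⟨hBw, hB'⟩ := hB w hw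
  have hg := hKw.sub hU hBw
  set g : Octonion → Octonion := fun z => K z w - B z w with hgdef
  have hpi := Real.pi_pos
  have h1 : ∫ z in U, mul (conj (K z w)) (g z) = ∫ z in U, mul (conj (B z w)) (g z) := by
    have h := (hK' g hg).symm.trans (hB' g hg)
    exact smul_right_injective _ (by positivity : (3 / Real.pi ^ 4 : ℝ) ≠ 0) h
  have h2 : ∫ z in U, mul (conj (g z)) (g z) = 0 := by
    rw [← sub_eq_zero, ← integral_sub (hg.integrable_conj_mul hU hKw)
      (hg.integrable_conj_mul hU hBw)] at h1
    rw [← h1]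
    congr 1
    ext1 z
    rw [← Octonion.sub_mul, ← conj_sub]
  simp only [conj_mul, integral_smul_const] at h2
  have h3 : ∫ z in U, ‖g z‖ ^ 2 = 0 :=
    (smul_eq_zero.1 h2).resolve_right fun h => by simpa [h] using norm_e 0
  have h4 : Integrable (fun z => ‖g z‖ ^ 2) (volume.restrict U) :=
    (memLp_two_iff_integrable_sq_norm hg.1.1).1 hg.1
  have h5 := (integral_eq_zero_iff_of_nonneg (fun z => by positivity) h4).1 h3
  have h6 : g =ᵐ[volume.restrict U] fun _ => 0 := by
    filter_upwards [h5] with z hz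
    simpa using hz
  have h7 := Measure.eqOn_open_of_ae_eq h6 hU hg.2.1.continuousOn continuousOn_const hz
  exact sub_eq_zero.1 h7

/-! ### Cotangent and series formulas -/

/-- Since |conj u| = |u|, the quotient u/|u|⁸ is q₀(conj u). -/
theorem stripTerm_eq (d : ℝ) (w : Octonion) (n : ℤ) (z : Octonion) :
    stripTerm d w n z = cauchyKernel (z + conj w + (2 * d * n) • e 0) := by
  rw [← conj_lattice_point, ← conj_cauchyKernel, cauchyKernel, conj_smul, conj_conj, stripTerm]

theorem scaled_cot_eq {d : ℝ} (hd : 0 < d) (u : Octonion) :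
    (Real.pi / (2 * d)) ^ 7 • cot ((Real.pi / (2 * d)) • u) = periodicKernel d u := by
  have hpi := Real.pi_pos
  rw [cot, periodicKernel, ← tsum_const_smul'']
  refine tsum_congr fun n => ?_
  rw [← cauchyKernel_smul (Real.pi / (2 * d)) (by positivity) (u + (2 * d * n) • e 0), smul_add,
    smul_smul]
  congr 4
  field_simp

end

end Octonion

theorem mainTheorem3 (d : ℝ) (hd : 0 < d) :
    ∃ B : Octonion → Octonion → Octonion,
      -- `B` is the Bergman kernel of the strip, and it is unique
      Octonion.IsBergmanKernel (Octonion.strip d) B ∧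
      (∀ K : Octonion → Octonion → Octonion, Octonion.IsBergmanKernel (Octonion.strip d) K →
        ∀ z ∈ Octonion.strip d, ∀ w ∈ Octonion.strip d, K z w = B z w) ∧
      ∀ z ∈ Octonion.strip d, ∀ w ∈ Octonion.strip d,
        -- the series converges to the rescaled cotangent
        (∀ n : ℤ, Octonion.conj z + w + (2 * d * n) • Octonion.e 0 ≠ 0) ∧
        HasSum (fun n : ℤ => Octonion.stripTerm d w n z)
          ((Real.pi / (2 * d)) ^ 7 •
            Octonion.cot ((Real.pi / (2 * d)) • (z + Octonion.conj w))) ∧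
        -- `B` is `-2` times the `x₀`-derivative of the rescaled cotangent
        LineDifferentiableAt ℝ (fun ζ : Octonion => (Real.pi / (2 * d)) ^ 7 •
          Octonion.cot ((Real.pi / (2 * d)) • (ζ + Octonion.conj w))) z (Octonion.e 0) ∧
        B z w = (-2 : ℝ) • Octonion.partialDeriv 0 (fun ζ : Octonion =>
          (Real.pi / (2 * d)) ^ 7 •
            Octonion.cot ((Real.pi / (2 * d)) • (ζ + Octonion.conj w))) z ∧
        -- `B` is `-2` times the `x₀`-derivative of the series
        B z w = (-2 : ℝ) • Octonion.partialDeriv 0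
          (fun ζ : Octonion => ∑' n : ℤ, Octonion.stripTerm d w n ζ) z ∧
        -- `B` is `-2` times the series of the `x₀`-derivatives
        (∀ n : ℤ, LineDifferentiableAt ℝ (Octonion.stripTerm d w n) z (Octonion.e 0)) ∧
        Summable (fun n : ℤ => Octonion.partialDeriv 0 (Octonion.stripTerm d w n) z) ∧
        B z w = (-2 : ℝ) • ∑' n : ℤ, Octonion.partialDeriv 0 (Octonion.stripTerm d w n) z := by
  open Octonion in
  refine ⟨stripKernel d, isBergmanKernel_stripKernel hd, fun K hK z hz w hw =>
    hK.eq (isOpen_strip d) (isBergmanKernel_stripKernel hd) hz hw, fun z hz w hw => ?_⟩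
  obtain ⟨h1, h2⟩ := re_add_conj_mem hz hw
  obtain ⟨c, hc, hc1, hc2⟩ := exists_margin h1 h2
  have haway := mem_awayFromLattice hd hc hc1.le hc2.le
  obtain ⟨L, hL, hL'⟩ := hasFDerivAt_periodicKernel hd h1 h2
  have hser : HasLineDerivAt ℝ (fun ζ => periodicKernel d (ζ + conj w))
      (periodicKernelDeriv d (z + conj w)) z (e 0) := by
    rw [← hL']
    exact (HasFDerivAt.comp (g := periodicKernel d) z hL
      ((hasFDerivAt_id z).add_const (conj w))).hasLineDerivAt (e 0)
  have hterm (n : ℤ) : HasLineDerivAt ℝ (stripTerm d w n)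
      (cauchyKernelDeriv (z + conj w + (2 * d * n) • e 0)) z (e 0) := by
    have hne : z + conj w + (2 * d * n) • e 0 ≠ 0 := fun h0 => by
      have := haway.2 n
      rw [h0, norm_zero] at this
      exact hc.not_ge this
    rw [funext (stripTerm_eq d w n), ← regKernelDeriv_zero_e_zero]
    exact (HasFDerivAt.comp (g := cauchyKernel) z (hasFDerivAt_cauchyKernel hne)
      (((hasFDerivAt_id z).add_const (conj w)).add_const _)).hasLineDerivAt (e 0)
  have hpart (n : ℤ) : partialDeriv 0 (stripTerm d w n) z =
      cauchyKernelDeriv (z + conj w + (2 * d * n) • e 0) := (hterm n).lineDeriv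
  have hsum := summable_shift hd hc (by norm_num) norm_cauchyKernelDeriv_le haway
  -- All the expressions now reduce to `periodicKernel` and the termwise derivatives; the last
  -- equality is then the definition of `stripKernel`.
  simp only [scaled_cot_eq hd, hpart]
  refine ⟨conj_add_ne_zero hd hw hz, ?_, hser.lineDifferentiableAt, ?_, ?_,
    fun n => (hterm n).lineDifferentiableAt, hsum, rfl⟩
  · simp only [stripTerm_eq]
    exact (summable_shift hd hc le_rfl norm_cauchyKernel_le haway).hasSum
  · rw [partialDeriv, hser.lineDeriv, stripKernel]
  · simp only [stripTerm_eq]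
    exact congrArg _ hser.lineDeriv.symm
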